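/- **Theorem 1.1.** Let $\mathbb K$ be a field of characteristic zero. A (central) arrangement $\mathscr A$ in a finite-dimensional $\mathbb K$-vector space $V$ is a finite set of linear hyperplanes of $V$. Let $x_1,\dots,x_\ell$ be a basis of $V^*$, $S=\mathbb K[x_1,\dots,x_\ell]=\mathrm{Sym}(V^*)$, and $Q=\prod_{H\in\mathscr A}\alpha_H\in S$, where $\alpha_H\in V^*$ is a linear form with kernel $H$. For $m\ge 0$ let $D^{(m)}(S)$ be the left $S$-submodule of $\mathrm{End}_{\mathbb K}(S)$ spanned by the operators $\partial^{\boldsymbol a}=\partial_1^{a_1}\cdots\partial_\ell^{a_\ell}$ with $|\boldsymbol a|=m$ (so $D^{(0)}(S)=S$), and let $$D^{(m)}(\mathscr A)=\{\theta\in D^{(m)}(S)\mid \theta(QS)\subseteq QS\}.$$ The arrangement $\mathscr A$ is called $m$-free if $D^{(m)}(\mathscr A)$ is a free $S$-module. An operator $\sum_{|\boldsymbol a|=m}f_{\boldsymbol a}\partial^{\boldsymbol a}$ is homogeneous of degree $d$ if every $f_{\boldsymbol a}$ is zero or a homogeneous polynomial of degree $d$. If $m\ge 1$ and $\mathscr A$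 is $m$-free, then $\exp_m(\mathscr A)$ denotes the multiset of degrees of a homogeneous $S$-basis of $D^{(m)}(\mathscr A)$; moreover $\exp_0(\mathscr A)=\{0\}$ for every $\mathscr A$. Let $\mathscr A_1$ and $\mathscr A_2$ be arrangements in $V_1$ and $V_2$ with $\dim V_1>0$ and $\dim V_2>0$, let $$\mathscr A_1\times\mathscr A_2=\{H_1\oplus V_2\mid H_1\in\mathscr A_1\}\cup\{V_1\oplus H_2\mid H_2\in\mathscr A_2\}$$ be the product arrangement in $V_1\oplus V_2$, and let $m\ge 0$. Fix any bases of $V_1^*$, $V_2^*$ and $(V_1\oplus V_2)^*$ as coordinates. 1. $\mathscr A_1\times\mathscr A_2$ is $m$-free if and only if both $\mathscr A_1$ and $\mathscr A_2$ are $i$-free for all $1\le i\le m$. 2. In that case, for every $0\le i\le m$, the multisets $\exp_i(\mathscr A_1)$ and $\exp_i(\mathscr A_2)$ exist and are uniquely determined. 3. Whenever $\exp_i(\mathscr A_1)$ and $\exp_i(\mathscr A_2)$ exist for all $0\le i\le m$, the exponents of the product exist, are uniquely determined, and are given, as a union (sum) of multisets counted with multiplicity, by $$\exp_m(\mathscr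 A_1\times\mathscr A_2)=\bigcup_{i=0}^{m}\{\,d+e\mid d\in\exp_i(\mathscr A_1),\ e\in\exp_{m-i}(\mathscr A_2)\,\}.$$ -/

import Mathlib

open MvPolynomial Module

noncomputable section

/-- A central hyperplane arrangement in `V`: a finite set of linear hyperplanes, i.e. of maximal
proper subspaces of `V`. -/
structure CentralArrangement (K V : Type*) [Field K] [AddCommGroup V] [Module K V] where
  hyperplanes : Finset (Submodule K V)
  isCoatom : ∀ H ∈ hyperplanes, IsCoatom H

namespace CentralArrangement

section Product

variable {K V₁ V₂ : Type*} [Field K] [AddCommGroup V₁] [Module K V₁] [AddCommGroup V₂] [Module K V₂]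

open Classical in
/-- The product arrangement in `V₁ ⊕ V₂`: the hyperplanes `H₁ ⊕ V₂` for `H₁ ∈ A₁` together with
the hyperplanes `V₁ ⊕ H₂` for `H₂ ∈ A₂`. -/
def prod (A₁ : CentralArrangement K V₁) (A₂ : CentralArrangement K V₂) :
    CentralArrangement K (V₁ × V₂) where
  hyperplanes := A₁.hyperplanes.image (fun H => H.prod (⊤ : Submodule K V₂)) ∪
    A₂.hyperplanes.image (fun H => (⊤ : Submodule K V₁).prod H)
  isCoatom := by
    intro H hH
    rw [Finset.mem_union, Finset.mem_image, Finset.mem_image] at hH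
    rcases hH with ⟨H₁, h, rfl⟩ | ⟨H₂, h, rfl⟩
    · have e : H₁.prod (⊤ : Submodule K V₂) = H₁.comap (LinearMap.fst K V₁ V₂) := by
        ext x; simp
      rw [e, Submodule.isCoatom_comap_iff LinearMap.fst_surjective]
      exact A₁.isCoatom _ h
    · have e : (⊤ : Submodule K V₁).prod H₂ = H₂.comap (LinearMap.snd K V₁ V₂) := by
        ext x; simp
      rw [e, Submodule.isCoatom_comap_iff LinearMap.snd_surjective]
      exact A₂.isCoatom _ h

end Product

section Forms

variable {K V : Type*} [Field K] [AddCommGroup V] [Module K V]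

theorem exists_ker_eq {H : Submodule K V} (hH : IsCoatom H) :
    ∃ α : Dual K V, LinearMap.ker α = H := by
  obtain ⟨f, hf, hle⟩ := Submodule.exists_le_ker_of_lt_top H hH.lt_top
  refine ⟨f, ?_⟩
  rcases hH.le_iff.1 hle with h | h
  · exact absurd (LinearMap.ker_eq_top.1 h) hf
  · exact h

open Classical in
/-- A linear form `α_H` with kernel `H` (for a hyperplane `H`; otherwise the junk value `0`). -/
def linearForm (H : Submodule K V) : Dual K V :=
  if h : ∃ α : Dual K V, LinearMap.ker α = H then h.choose else 0

theorem ker_linearForm {H : Submodule K V} (hH : IsCoatom H) :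
    LinearMap.ker (linearForm H) = H := by
  have h := exists_ker_eq hH
  rw [linearForm, dif_pos h]
  exact h.choose_spec

variable {ι : Type*} [Fintype ι]

/-- The linear form `α ∈ V*` as a polynomial in the coordinates `x`, where `x` is a basis of `V*`
and `S = Sym(V*)` is identified with `K[x_i | i ∈ ι]`. -/
def formPoly (x : Basis ι K (Dual K V)) (α : Dual K V) : MvPolynomial ι K :=
  ∑ i, C (x.repr α i) * X i

/-- The defining polynomial `Q(A) = ∏_{H ∈ A} α_H`. -/
def definingPoly (x : Basis ι K (Dual K V)) (A : CentralArrangement K V) : MvPolynomial ι K :=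
  ∏ H ∈ A.hyperplanes, formPoly x (linearForm H)

end Forms

section Operators

variable (K : Type*) {ι : Type*} [Field K]

theorem commute_pderiv (i j : ι) :
    Commute ((pderiv i).toLinearMap : End K (MvPolynomial ι K)) (pderiv j).toLinearMap := by
  classical
  have h : ⁅(pderiv i : Derivation K (MvPolynomial ι K) (MvPolynomial ι K)),
      (pderiv j : Derivation K (MvPolynomial ι K) (MvPolynomial ι K))⁆ = 0 := by
    apply MvPolynomial.derivation_ext
    intro k
    rw [Derivation.commutator_apply, pderiv_X, pderiv_X]
    simp [Pi.single_apply, apply_ite]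
  refine LinearMap.ext fun p => ?_
  have h' := congrArg (fun D : Derivation K (MvPolynomial ι K) (MvPolynomial ι K) => D p) h
  simp only [Derivation.commutator_apply, Derivation.zero_apply] at h'
  exact sub_eq_zero.1 h'

variable [Fintype ι]

/-- The operator `∂^a = ∏_i ∂_i^{a_i}` in `End_K(S)`, for a multi-index `a`. -/
def partialPow (a : ι → ℕ) : End K (MvPolynomial ι K) :=
  Finset.univ.noncommProd (fun i => ((pderiv i).toLinearMap : End K (MvPolynomial ι K)) ^ a i)
    (fun i _ j _ _ => (commute_pderiv K i j).pow_pow (a i) (a j))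

variable (ι) in
/-- `D^(m)(S)`: the `S`-submodule of `End_K(S)` spanned by the `∂^a` with `|a| = m`. The action
of `S` on `End_K(S)` is multiplication from the left, `(f • θ) g = f * θ g`. For `m = 0` this is
`S` itself, acting by multiplication. -/
def diffOps (m : ℕ) : Submodule (MvPolynomial ι K) (End K (MvPolynomial ι K)) :=
  Submodule.span _ {θ | ∃ a : ι → ℕ, ∑ i, a i = m ∧ θ = partialPow K a}

/-- `θ = ∑_{|a| = m} f_a ∂^a` is homogeneous of degree `d`: every `f_a` is zero or a homogeneous
polynomial of degree `d`. -/
def IsHomogeneousOp [DecidableEq ι] (m d : ℕ) (θ : End K (MvPolynomial ι K)) : Prop :=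
  ∃ f : (ι → ℕ) → MvPolynomial ι K, (∀ a, (f a).IsHomogeneous d) ∧
    θ = ∑ a ∈ Finset.piAntidiag Finset.univ m, f a • partialPow K a

end Operators

section Free

variable {K V ι : Type*} [Field K] [AddCommGroup V] [Module K V] [Fintype ι]

/-- `D^(m)(A) = {θ ∈ D^(m)(S) | θ(QS) ⊆ QS}`, the module of `m`-th order `A`-differential
operators, with respect to the coordinates `x`. -/
def diffModule (x : Basis ι K (Dual K V)) (A : CentralArrangement K V) (m : ℕ) :
    Submodule (MvPolynomial ι K) (End K (MvPolynomial ι K)) where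
  carrier := {θ | θ ∈ diffOps K ι m ∧
    ∀ p ∈ Ideal.span {A.definingPoly x}, θ p ∈ Ideal.span {A.definingPoly x}}
  zero_mem' := ⟨Submodule.zero_mem _, fun _ _ => Ideal.zero_mem _⟩
  add_mem' := fun hθ hη =>
    ⟨Submodule.add_mem _ hθ.1 hη.1, fun p hp => Ideal.add_mem _ (hθ.2 p hp) (hη.2 p hp)⟩
  smul_mem' := fun f _ hθ =>
    ⟨Submodule.smul_mem _ f hθ.1, fun p hp => Ideal.mul_mem_left _ f (hθ.2 p hp)⟩

/-- `A` is `m`-free: `D^(m)(A)` is a free `S`-module. -/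
def IsMFree (x : Basis ι K (Dual K V)) (A : CentralArrangement K V) (m : ℕ) : Prop :=
  Module.Free (MvPolynomial ι K) (A.diffModule x m)

/-- `E` is the multiset `exp_m(A)`: for `m ≥ 1` it is the multiset of the degrees of the members
of a homogeneous `S`-basis of `D^(m)(A)`, and `exp_0(A) = {0}` by convention. -/
def IsExponents [DecidableEq ι] (x : Basis ι K (Dual K V)) (A : CentralArrangement K V)
    (m : ℕ) (E : Multiset ℕ) : Prop :=
  (m = 0 ∧ E = {0}) ∨
    (1 ≤ m ∧ ∃ (n : ℕ) (θ : Basis (Fin n) (MvPolynomial ι K) (A.diffModule x m)) (d : Fin n → ℕ),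
      (∀ j, IsHomogeneousOp K m (d j) (θ j : End K (MvPolynomial ι K))) ∧
        E = Finset.univ.val.map d)

end Free

end CentralArrangement

end

/-! Let `S = S₁ ⊗ S₂` be the coordinate ring of `V₁ × V₂`. The defining polynomial of the product is
`Q₁ ⊗ Q₂` up to a nonzero scalar, and everything rests on the decomposition of `D^(m)(A₁ × A₂)` as
the direct sum over `i + j = m` of `D^(i)(A₁) ⊗_K D^(j)(A₂)`, where `u ⊗ w` acts on `S` as `box Ψ u
w`.

The hard inclusion is `IsLinearTensorEquiv.preservingOps_le_boxSpan`. Write an operator preserving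
`QS` as `∑ u_k ⊗ v_k` with the `v_k` linearly independent over `K`. A functional on `S₁` that kills
`Q₁S₁` turns it into a `K`-combination of the `v_k` that vanishes on `Q₂S₂`. A differential operator
vanishing on a nonzero ideal is zero, so all coefficients vanish, and hence every `u_k` preserves
`Q₁S₁` (`dvd_of_sum_box_preserves`). Repeating this with the factors exchanged treats the other
side.

If both factors are free in all orders up to `m`, products of homogeneous bases form a homogeneous
basis of the product module, and degrees add (`IsLinearTensorEquiv.exists_box_basis`). Conversely,
tensoring with a fixed nonzero operator of order `m - i` embeds `D^(i)(A₁)` as an `S₁`-direct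
summand of `D^(m)(A₁ × A₂)`; the latter is free over `S`, hence over `S₁`, so the summand is
projective (`IsLinearTensorEquiv.projective_left`).

A finitely generated graded projective module over a polynomial ring has a homogeneous basis, by
Nakayama's lemma, and its degrees are unique, by inspecting the determinant of a base change. This
turns projectivity into freeness and makes exponents exist and be unique.

Characteristic zero enters through division by `a!` when the coefficients of an operator are read
from its values on monomials. -/

open scoped TensorProduct

namespace CentralArrangement

/-! ### Independent families of submodules -/

section Independence

/-- Apply `proj i` to a vanishing sum, by strong induction on `i`: the components below `i` are
already zero and those above are killed. Nothing is required of `proj i` on `p j` with `j < i`,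
which is what makes the criterion usable for `symbolProj`. -/
theorem iSupIndep_of_triangular_proj {R N : Type*} [Ring R] [AddCommGroup N] [Module R N]
    (p : ℕ → Submodule R N) (proj : ℕ → N →ₗ[R] N) (hself : ∀ m, ∀ x ∈ p m, proj m x = x)
    (hzero : ∀ m j, m < j → ∀ x ∈ p j, proj m x = 0) : iSupIndep p := by
  classical
  refine iSupIndep_of_dfinsupp_lsum_injective _ ?_
  refine (injective_iff_map_eq_zero _).2 fun f hf => ?_
  rw [DFinsupp.lsum_apply_apply, DFinsupp.sumAddHom_apply] at hf
  ext i
  induction i using Nat.strong_induction_on with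
  | _ i ih =>
    have h1 := congrArg (proj i) hf
    rw [DFinsupp.sum, map_sum, map_zero] at h1
    by_cases hi : i ∈ f.support
    · rw [Finset.sum_eq_single_of_mem i hi] at h1
      · exact (hself i _ (f i).2).symm.trans h1
      · intro j _ hj
        rcases lt_or_gt_of_ne hj with h | h
        · have := ih j h
          simpa using congrArg (proj i) this
        · exact hzero i j h _ (f j).2
    · rw [DFinsupp.notMem_support_iff.1 hi]; rfl

theorem linearIndependent_sigma_of_iSupIndep {R N I : Type*} [Ring R] [AddCommGroup N]
    [Module R N] {p : I → Submodule R N} (hp : iSupIndep p) {κ : I → Type*}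
    (v : ∀ i, κ i → p i) (hv : ∀ i, LinearIndependent R (v i)) :
    LinearIndependent R (fun k : Σ i, κ i => (v k.1 k.2 : N)) := by
  classical
  have hinj := hp.dfinsupp_lsum_injective
  rw [linearIndependent_iff'] 
  intro s g hg
  let f : Π₀ i, p i := ∑ k ∈ s, DFinsupp.single k.1 (g k • v k.1 k.2)
  have hf : f = 0 := by
    apply hinj
    rw [map_zero, map_sum]
    simpa using hg
  rintro ⟨i, k⟩ hk
  have hfi : ∑ k ∈ s.preimage (Sigma.mk i) sigma_mk_injective.injOn, g ⟨i, k⟩ • v i k = 0 := by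
    have h1 := DFunLike.congr_fun hf i
    simp only [f, DFinsupp.finsetSum_apply] at h1
    rw [← Finset.sum_filter_add_sum_filter_not s (fun k => k.1 = i),
      Finset.sum_eq_zero (s := s.filter fun k => ¬ k.1 = i), add_zero] at h1
    · refine Eq.trans ?_ h1
      refine Finset.sum_bij' (fun k _ => ⟨i, k⟩)
        (fun k hk => (Finset.mem_filter.1 hk).2 ▸ k.2) ?_ ?_ ?_ ?_ ?_
      · intro a ha; simpa using ha
      · rintro ⟨j, a⟩ ha
        obtain ⟨h2, rfl⟩ := Finset.mem_filter.1 ha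
        simpa using h2
      · intro a ha; rfl
      · rintro ⟨j, a⟩ ha
        obtain ⟨h1, rfl⟩ := Finset.mem_filter.1 ha
        rfl
      · intro a ha; simp
    · intro k hk
      exact DFinsupp.single_eq_of_ne (Ne.symm (Finset.mem_filter.1 hk).2)
  exact linearIndependent_iff'.1 (hv i) _ (fun k => g ⟨i, k⟩) hfi k (by simpa using hk)

theorem linearIndependent_coe_basis {R N κ : Type*} [Ring R] [AddCommGroup N] [Module R N]
    {p : Submodule R N} (b : Basis κ R p) : LinearIndependent R fun k => (b k : N) :=
  b.linearIndependent.map' p.subtype p.ker_subtype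

theorem exists_eq_sum_smul_basis {R N κ : Type*} [Ring R] [AddCommGroup N] [Module R N]
    {p : Submodule R N} [Fintype κ] (b : Basis κ R p) {x : N} (hx : x ∈ p) :
    ∃ f : κ → R, x = ∑ j, f j • (b j : N) := by
  refine ⟨b.repr ⟨x, hx⟩, ?_⟩
  have h := congrArg p.subtype (b.sum_repr ⟨x, hx⟩)
  simp only [map_sum, map_smul, Submodule.subtype_apply] at h
  exact h.symm

end Independence

/-! ### Order of an operator by iterated commutators -/

section Order

variable {K ι : Type*} [Field K]

/-- `OrderLT n T`: the operator `T` has order less than `n` in the sense of iterated commutators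
with the variables. -/
def OrderLT : ℕ → End K (MvPolynomial ι K) → Prop
  | 0, T => T = 0
  | n + 1, T => ∀ i, OrderLT n (T * LinearMap.mulLeft K (X i) - LinearMap.mulLeft K (X i) * T)

theorem OrderLT.zero (n : ℕ) : OrderLT n (0 : End K (MvPolynomial ι K)) := by
  induction n with
  | zero => rfl
  | succ n ih => intro i; simpa using ih

theorem OrderLT.add {n : ℕ} : ∀ {T U : End K (MvPolynomial ι K)}, OrderLT n T → OrderLT n U →
    OrderLT n (T + U) := by
  induction n with
  | zero => intro T U hT hU; rw [OrderLT] at *; simp [hT, hU]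
  | succ n ih =>
    intro T U hT hU i
    have := ih (hT i) (hU i)
    rwa [show (T + U) * LinearMap.mulLeft K (X i) - LinearMap.mulLeft K (X i) * (T + U) =
      (T * LinearMap.mulLeft K (X i) - LinearMap.mulLeft K (X i) * T) +
      (U * LinearMap.mulLeft K (X i) - LinearMap.mulLeft K (X i) * U) by noncomm_ring]

theorem OrderLT.smul {n : ℕ} (f : MvPolynomial ι K) : ∀ {T : End K (MvPolynomial ι K)},
    OrderLT n T → OrderLT n (f • T) := by
  induction n with
  | zero => intro T hT; rw [OrderLT] at *; simp [hT]
  | succ n ih =>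
    intro T hT i
    have := ih (hT i)
    have h : f • T * LinearMap.mulLeft K (X i) - LinearMap.mulLeft K (X i) * (f • T) =
        f • (T * LinearMap.mulLeft K (X i) - LinearMap.mulLeft K (X i) * T) := by
      refine LinearMap.ext fun p => ?_
      simp [mul_sub, mul_left_comm]
    rwa [h]

theorem OrderLT.succ {n : ℕ} : ∀ {T : End K (MvPolynomial ι K)}, OrderLT n T →
    OrderLT (n + 1) T := by
  induction n with
  | zero => intro T hT i; rw [OrderLT] at *; simp [hT]
  | succ n ih => exact fun hT i => ih (hT i)

theorem OrderLT.mono {n k : ℕ} (h : n ≤ k) {T : End K (MvPolynomial ι K)} (hT : OrderLT n T) :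
    OrderLT k T := by
  induction k, h using Nat.le_induction with
  | base => exact hT
  | succ k _ ih => exact ih.succ

/-- The Leibniz rule gives `[∂_i T, x_j] = ∂_i [T, x_j] + ∂_i(x_j) T`; induction applies to the
first term, and the second has the order of `T`. -/
theorem OrderLT.pderiv_mul {n : ℕ} (i : ι) : ∀ {T : End K (MvPolynomial ι K)}, OrderLT n T →
    OrderLT (n + 1) ((pderiv i).toLinearMap * T) := by
  classical
  induction n with
  | zero => intro T hT; rw [OrderLT] at hT; rw [hT, mul_zero]; exact OrderLT.zero _
  | succ n ih =>
    intro T hT j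
    have h1 := (ih (hT j)).add (hT.smul (pderiv i (X j)))
    convert h1 using 1
    refine LinearMap.ext fun p => ?_
    simp [Derivation.leibniz]
    ring

theorem OrderLT.one : OrderLT 1 (1 : End K (MvPolynomial ι K)) := by
  intro i
  rw [OrderLT]; simp

/-- Each commutator `[T, x_i]` also vanishes on `QS` and has smaller order, so it is zero by
induction. Then `T` is `S`-linear, `Q * T p = T (Q * p) = 0`, and `S` is a domain. -/
theorem OrderLT.eq_zero_of_vanishes {Q : MvPolynomial ι K} (hQ : Q ≠ 0) {n : ℕ} :
    ∀ {T : End K (MvPolynomial ι K)}, OrderLT n T → (∀ p, T (Q * p) = 0) → T = 0 := by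
  induction n with
  | zero => intro T hT _; exact hT
  | succ n ih =>
    intro T hT hv
    have hcomm : ∀ i p, T (X i * p) = X i * T p := by
      intro i p
      have := ih (hT i) (fun p => by simp [hv, mul_left_comm (X i) Q])
      simpa [sub_eq_zero] using congrArg (fun U : End K (MvPolynomial ι K) => U p) this
    have hlin : ∀ f p, T (f * p) = f * T p := by
      intro f
      induction f using MvPolynomial.induction_on with
      | C a => intro p; simp [← MvPolynomial.smul_eq_C_mul]
      | add f g hf hg => intro p; rw [add_mul, map_add, hf, hg, add_mul]
      | mul_X f i hf => intro p; rw [mul_assoc, hf, hcomm, mul_assoc]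
    refine LinearMap.ext fun p => ?_
    have := hv p
    rw [hlin] at this
    exact (mul_eq_zero.1 this).resolve_left hQ

end Order

/-! ### Constant coefficient operators and the coefficients of an operator -/

theorem pairwise_commute_pderiv_pow {K ι : Type*} [Field K] (a b : ι → ℕ) (s : Set ι) :
    s.Pairwise fun i j => Commute
      (((pderiv i).toLinearMap : End K (MvPolynomial ι K)) ^ a i) ((pderiv j).toLinearMap ^ b j) :=
  fun i _ j _ _ => (commute_pderiv K i j).pow_pow _ _

section OneRing

variable {K ι : Type*} [Field K] [Fintype ι]

/-- The exponent vector of the monomial `X^a`. -/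
noncomputable def monomialOf (a : ι → ℕ) : MvPolynomial ι K :=
  monomial (Finsupp.equivFunOnFinite.symm a) 1

theorem partialPow_eq_noncommProd (a : ι → ℕ)
    (h : (↑(Finset.univ : Finset ι) : Set ι).Pairwise (Function.onFun Commute
      fun i => ((pderiv i).toLinearMap : End K (MvPolynomial ι K)) ^ a i)) :
    partialPow K a = Finset.univ.noncommProd
      (fun i => ((pderiv i).toLinearMap : End K (MvPolynomial ι K)) ^ a i) h := rfl

theorem partialPow_zero : partialPow K (0 : ι → ℕ) = 1 := by
  rw [partialPow_eq_noncommProd _ (pairwise_commute_pderiv_pow _ _ _),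
    Finset.noncommProd_eq_pow_card _ _ _ 1 (by simp)]
  simp

theorem partialPow_add (a b : ι → ℕ) :
    partialPow K (a + b) = partialPow K a * partialPow K b := by
  rw [partialPow_eq_noncommProd _ (pairwise_commute_pderiv_pow _ _ _),
    partialPow_eq_noncommProd a (pairwise_commute_pderiv_pow _ _ _),
    partialPow_eq_noncommProd b (pairwise_commute_pderiv_pow _ _ _),
    ← Finset.noncommProd_mul_distrib]
  · exact Finset.noncommProd_congr rfl (fun i _ => pow_add _ _ _) _
  · exact pairwise_commute_pderiv_pow _ _ _

theorem partialPow_single [DecidableEq ι] (i : ι) :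
    partialPow K (Pi.single i 1 : ι → ℕ) = (pderiv i).toLinearMap := by
  have h : (Finset.univ : Finset ι) = insert i (Finset.univ.erase i) := by simp
  rw [partialPow_eq_noncommProd _ (pairwise_commute_pderiv_pow _ _ _),
    Finset.noncommProd_congr h (fun _ _ => rfl)]
  refine (Finset.noncommProd_insert_of_notMem _ _ _ _ (by simp)).trans ?_
  rw [Finset.noncommProd_eq_pow_card _ _ _ 1]
  · simp
  · intro j hj
    simp [Pi.single_eq_of_ne (Finset.ne_of_mem_erase hj)]

theorem partialPow_commute (a b : ι → ℕ) : partialPow K a * partialPow K b =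
    partialPow K b * partialPow K a := by
  rw [← partialPow_add, add_comm, partialPow_add]

/-- Peels one derivative off `∂^a`; the step of the inductions on the order below. -/
theorem exists_eq_single_add [DecidableEq ι] {a : ι → ℕ} {m : ℕ} (h : ∑ i, a i = m + 1) :
    ∃ (i : ι) (b : ι → ℕ), a = Pi.single i 1 + b ∧ ∑ i, b i = m := by
  obtain ⟨i, hi⟩ : ∃ i, a i ≠ 0 := by
    by_contra! h0
    simp [h0] at h
  have hle : Pi.single i 1 ≤ a := by
    intro j
    rcases eq_or_ne j i with rfl | hj
    · simpa using Nat.one_le_iff_ne_zero.2 hi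
    · simp [hj]
  refine ⟨i, a - Pi.single i 1, (add_tsub_cancel_of_le hle).symm, ?_⟩
  have h2 : ∑ j, (Pi.single i 1 + (a - Pi.single i 1) : ι → ℕ) j = m + 1 := by
    rw [add_tsub_cancel_of_le hle, h]
  simp only [Pi.add_apply, Finset.sum_add_distrib, Finset.sum_pi_single', Finset.mem_univ,
    if_true] at h2
  omega

variable (K ι) in
/-- The constant coefficient operators of order `m`. -/
noncomputable def constOps (m : ℕ) : Submodule K (End K (MvPolynomial ι K)) :=
  Submodule.span K {θ | ∃ a : ι → ℕ, ∑ i, a i = m ∧ θ = partialPow K a}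

theorem partialPow_mem_constOps {a : ι → ℕ} {m : ℕ} (h : ∑ i, a i = m) :
    partialPow K a ∈ constOps K ι m := Submodule.subset_span ⟨a, h, rfl⟩

theorem partialPow_mem_diffOps {a : ι → ℕ} {m : ℕ} (h : ∑ i, a i = m) :
    partialPow K a ∈ diffOps K ι m := Submodule.subset_span ⟨a, h, rfl⟩

theorem constOps_le_diffOps (m : ℕ) :
    constOps K ι m ≤ (diffOps K ι m).restrictScalars K := by
  refine Submodule.span_le.2 ?_
  rintro _ ⟨a, h, rfl⟩
  exact partialPow_mem_diffOps h

theorem one_mem_constOps : (1 : End K (MvPolynomial ι K)) ∈ constOps K ι 0 := by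
  rw [← partialPow_zero]
  exact partialPow_mem_constOps (by simp)

theorem pderiv_mul_mem_constOps (i : ι) {m : ℕ} {θ : End K (MvPolynomial ι K)}
    (hθ : θ ∈ constOps K ι m) :
    (pderiv i).toLinearMap * θ ∈ constOps K ι (m + 1) := by
  classical
  induction hθ using Submodule.span_induction with
  | mem x hx =>
    obtain ⟨a, h, rfl⟩ := hx
    rw [← partialPow_single, ← partialPow_add]
    refine partialPow_mem_constOps ?_
    simp [Finset.sum_add_distrib, h, add_comm]
  | zero => simp
  | add x y _ _ hx hy => rw [mul_add]; exact add_mem hx hy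
  | smul c x _ hx => rw [mul_smul_comm]; exact Submodule.smul_mem _ c hx

theorem derivation_eq_sum_pderiv (D : Derivation K (MvPolynomial ι K) (MvPolynomial ι K)) :
    D = ∑ i, D (X i) • pderiv i := by
  classical
  apply MvPolynomial.derivation_ext
  intro k
  have h : (∑ i, D (X i) • pderiv i : Derivation K (MvPolynomial ι K) (MvPolynomial ι K)) (X k) =
      ∑ i, (D (X i) • pderiv i : Derivation K (MvPolynomial ι K) (MvPolynomial ι K)) (X k) := by
    rw [← Derivation.coeFnAddMonoidHom_apply, map_sum, Finset.sum_apply]; rfl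
  rw [h]
  simp [pderiv_X, Pi.single_apply]

/-- A derivation that is constant on the variables is a constant coefficient operator of
order one. -/
theorem derivation_mul_mem_constOps (D : Derivation K (MvPolynomial ι K) (MvPolynomial ι K))
    (hD : ∀ i, ∃ c, D (X i) = C c) {m : ℕ} {θ : End K (MvPolynomial ι K)}
    (hθ : θ ∈ constOps K ι m) : D.toLinearMap * θ ∈ constOps K ι (m + 1) := by
  choose c hc using hD
  have h : D.toLinearMap = ∑ i, c i • (pderiv i).toLinearMap := by
    refine LinearMap.ext fun p => ?_
    have := congrArg (fun E : Derivation K (MvPolynomial ι K) (MvPolynomial ι K) => E p)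
      (derivation_eq_sum_pderiv D)
    simp only [← Derivation.coeFnAddMonoidHom_apply, map_sum, Finset.sum_apply] at this
    simp only [LinearMap.sum_apply]
    refine this.trans (Finset.sum_congr rfl fun i _ => ?_)
    simp [hc, MvPolynomial.smul_eq_C_mul]
  rw [h, Finset.sum_mul]
  refine sum_mem fun i _ => ?_
  rw [smul_mul_assoc]
  exact Submodule.smul_mem _ _ (pderiv_mul_mem_constOps i hθ)

/-! ### Pairing with monomials -/

theorem monomialOf_degree {a : ι → ℕ} {m : ℕ} (h : ∑ i, a i = m) :
    (monomialOf a : MvPolynomial ι K).IsHomogeneous m := by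
  apply isHomogeneous_monomial
  rw [← h, Finsupp.degree_eq_sum]
  rfl

/-- On monomials of degree at most `|a|` the operator `∂^a` is diagonal with entry `a!`. The bound
on the degree of `b` is essential: higher monomials need not be killed. -/
theorem partialPow_monomial [DecidableEq ι] (m : ℕ) : ∀ (a : ι → ℕ) (b : ι →₀ ℕ) (c : K),
    ∑ i, a i = m → b.degree ≤ m → partialPow K a (monomial b c) =
      if a = b then C (c * ∏ i, ((a i).factorial : K)) else 0 := by
  induction m with
  | zero =>
    intro a b c ha hb
    have ha0 : a = 0 := by
      funext i
      exact (Finset.sum_eq_zero_iff.1 ha) i (Finset.mem_univ i)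
    have hb0 : b = 0 := by
      rw [Nat.le_zero, Finsupp.degree_eq_zero_iff] at hb
      exact hb
    subst ha0 hb0
    rw [partialPow_zero]
    simp
  | succ m ih =>
    intro a b c ha hb
    obtain ⟨i, a', rfl, ha'⟩ := exists_eq_single_add ha
    rw [partialPow_add, partialPow_commute, partialPow_single]
    change partialPow K a' (pderiv i (monomial b c)) = _
    rw [pderiv_monomial]
    by_cases hbi : b i = 0
    · have : ¬ (Pi.single i 1 + a' : ι → ℕ) = b := by
        intro h
        have := congrFun h i
        simp [hbi] at this
      simp [this, hbi]
    · have hsb : Finsupp.single i 1 + (b - Finsupp.single i 1) = b :=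
        add_tsub_cancel_of_le (by simpa using Nat.one_le_iff_ne_zero.2 hbi)
      have hdeg : (b - Finsupp.single i 1).degree ≤ m := by
        have := congrArg Finsupp.degree hsb
        rw [Finsupp.degree.map_add, Finsupp.degree_single] at this
        omega
      rw [ih a' _ _ ha' hdeg]
      have hiff : a' = (b - Finsupp.single i 1 : ι →₀ ℕ) ↔ (Pi.single i 1 + a' : ι → ℕ) = b := by
        constructor
        · intro h
          rw [h]
          conv_rhs => rw [← hsb]
          rw [Finsupp.coe_add, Finsupp.single_eq_pi_single]
        · intro h
          funext j
          have := congrFun h j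
          simp only [Pi.add_apply] at this
          rw [Finsupp.tsub_apply, ← this, Finsupp.single_eq_pi_single]
          simp
      by_cases h : a' = (b - Finsupp.single i 1 : ι →₀ ℕ)
      · rw [if_pos h, if_pos (hiff.1 h)]
        have h' := hiff.1 h
        congr 1
        rw [mul_assoc]
        congr 1
        rw [← Finset.mul_prod_erase Finset.univ _ (Finset.mem_univ i), ← mul_assoc]
        refine Eq.trans ?_ (Finset.mul_prod_erase Finset.univ
          (fun j => (((Pi.single i 1 + a' : ι → ℕ) j).factorial : K)) (Finset.mem_univ i))
        congr 1
        · have hb' := congrFun h' i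
          rw [← hb']
          simp only [Pi.add_apply, Pi.single_eq_same]
          rw [add_comm 1, Nat.factorial_succ]
          push_cast; ring
        · refine Finset.prod_congr rfl fun j hj => ?_
          simp [Pi.single_eq_of_ne (Finset.ne_of_mem_erase hj)]
      · rw [if_neg h, if_neg (fun h' => h (hiff.2 h'))]

theorem partialPow_monomialOf [DecidableEq ι] {m : ℕ} {a b : ι → ℕ} (ha : ∑ i, a i = m)
    (hb : ∑ i, b i ≤ m) : partialPow K a (monomialOf b) =
      if a = b then C (∏ i, ((a i).factorial : K)) else 0 := by
  rw [monomialOf, partialPow_monomial m a _ _ ha (by rw [Finsupp.degree_eq_sum]; exact hb)]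
  simp

theorem prod_factorial_ne_zero [CharZero K] (a : ι → ℕ) : (∏ i, ((a i).factorial : K)) ≠ 0 :=
  Finset.prod_ne_zero_iff.2 fun _ _ => Nat.cast_ne_zero.2 (Nat.factorial_ne_zero _)

/-- The `S`-linear projection onto `D^(m)(S)` that reads off the coefficients of an operator from
its values on the monomials of degree `m`. -/
noncomputable def symbolProj (K ι : Type*) [Field K] [Fintype ι] [DecidableEq ι] (m : ℕ) :
    End K (MvPolynomial ι K) →ₗ[MvPolynomial ι K] End K (MvPolynomial ι K) where
  toFun θ := ∑ a ∈ Finset.piAntidiag Finset.univ m,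
    (C (∏ i, ((a i).factorial : K))⁻¹ * θ (monomialOf a)) • partialPow K a
  map_add' θ η := by
    simp only [LinearMap.add_apply, mul_add, add_smul, Finset.sum_add_distrib]
  map_smul' f θ := by
    simp only [LinearMap.smul_apply, smul_eq_mul, RingHom.id_apply, Finset.smul_sum, smul_smul]
    refine Finset.sum_congr rfl fun _ _ => ?_
    rw [mul_left_comm]

theorem symbolProj_apply [DecidableEq ι] (m : ℕ) (θ : End K (MvPolynomial ι K)) :
    symbolProj K ι m θ = ∑ a ∈ Finset.piAntidiag Finset.univ m,
      (C (∏ i, ((a i).factorial : K))⁻¹ * θ (monomialOf a)) • partialPow K a := rfl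

/-- Orders above `m` vanish on monomials of degree `m`. Orders below `m` are excluded because they
need not vanish there, so `symbolProj` is only triangular with respect to the order. -/
theorem symbolProj_partialPow [CharZero K] [DecidableEq ι] {m : ℕ} {a : ι → ℕ}
    (ha : m ≤ ∑ i, a i) : symbolProj K ι m (partialPow K a) =
      if ∑ i, a i = m then partialPow K a else 0 := by
  rw [symbolProj_apply]
  split_ifs with h
  · rw [Finset.sum_eq_single a]
    · rw [partialPow_monomialOf h h.le, if_pos rfl, ← C_mul,
        inv_mul_cancel₀ (prod_factorial_ne_zero a), C_1, one_smul]
    · intro b hb hba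
      rw [partialPow_monomialOf h (by simpa using (Finset.mem_piAntidiag.1 hb).1.le),
        if_neg (Ne.symm hba)]
      simp
    · intro h'
      exact absurd (Finset.mem_piAntidiag.2 ⟨h, by simp⟩) h'
  · refine Finset.sum_eq_zero fun b hb => ?_
    have hb' := (Finset.mem_piAntidiag.1 hb).1
    rw [partialPow_monomialOf rfl (hb'.le.trans ha), if_neg]
    · simp
    · rintro rfl
      exact h hb'

theorem symbolProj_eq_self [CharZero K] [DecidableEq ι] {m : ℕ} {θ : End K (MvPolynomial ι K)}
    (hθ : θ ∈ diffOps K ι m) : symbolProj K ι m θ = θ := by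
  induction hθ using Submodule.span_induction with
  | mem x hx =>
    obtain ⟨a, h, rfl⟩ := hx
    rw [symbolProj_partialPow h.ge, if_pos h]
  | zero => simp
  | add x y _ _ hx hy => rw [map_add, hx, hy]
  | smul c x _ hx => rw [map_smul, hx]

theorem symbolProj_eq_zero [CharZero K] [DecidableEq ι] {m j : ℕ} (hj : m < j)
    {θ : End K (MvPolynomial ι K)} (hθ : θ ∈ diffOps K ι j) : symbolProj K ι m θ = 0 := by
  induction hθ using Submodule.span_induction with
  | mem x hx =>
    obtain ⟨a, h, rfl⟩ := hx
    rw [symbolProj_partialPow (by omega), if_neg (by omega)]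
  | zero => simp
  | add x y _ _ hx hy => rw [map_add, hx, hy, add_zero]
  | smul c x _ hx => rw [map_smul, hx, smul_zero]

theorem iSupIndep_diffOps [CharZero K] : iSupIndep (diffOps K ι) := by
  classical
  exact iSupIndep_of_triangular_proj _ (symbolProj K ι) (fun _ _ => symbolProj_eq_self)
    (fun _ _ h _ => symbolProj_eq_zero h)

theorem orderLT_partialPow (m : ℕ) : ∀ a : ι → ℕ, ∑ i, a i = m →
    OrderLT (m + 1) (partialPow K a) := by
  classical
  induction m with
  | zero =>
    intro a ha
    have ha0 : a = 0 := by
      funext i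
      exact (Finset.sum_eq_zero_iff.1 ha) i (Finset.mem_univ i)
    rw [ha0, partialPow_zero]
    exact OrderLT.one
  | succ m ih =>
    intro a ha
    obtain ⟨i, b, rfl, hb⟩ := exists_eq_single_add ha
    rw [partialPow_add, partialPow_single]
    exact (ih b hb).pderiv_mul i

theorem exists_orderLT {T : End K (MvPolynomial ι K)} (hT : T ∈ ⨆ k, diffOps K ι k) :
    ∃ n, OrderLT n T := by
  induction hT using Submodule.iSup_induction' with
  | mem k x hx =>
    refine ⟨k + 1, ?_⟩
    induction hx using Submodule.span_induction with
    | mem x hx =>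
      obtain ⟨a, ha, rfl⟩ := hx
      exact orderLT_partialPow k a ha
    | zero => exact OrderLT.zero _
    | add x y _ _ hx hy => exact hx.add hy
    | smul c x _ hx => exact hx.smul c
  | zero => exact ⟨0, rfl⟩
  | add x y _ _ hx hy =>
    obtain ⟨n, hn⟩ := hx
    obtain ⟨k, hk⟩ := hy
    exact ⟨max n k, (hn.mono (le_max_left _ _)).add (hk.mono (le_max_right _ _))⟩

/-- A differential operator that vanishes on a nonzero principal ideal is zero. -/
theorem eq_zero_of_vanishes {Q : MvPolynomial ι K} (hQ : Q ≠ 0) {T : End K (MvPolynomial ι K)}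
    (hT : T ∈ ⨆ k, diffOps K ι k) (hv : ∀ p, T (Q * p) = 0) : T = 0 :=
  (exists_orderLT hT).choose_spec.eq_zero_of_vanishes hQ hv

/-! ### Homogeneous operators -/

/-- The value of `∑ f_a ∂^a` at `x^b` with `|b| = m` is `b! f_b`, so homogeneity can be tested on
values. This makes it a condition on the coordinates `opCoord`. -/
theorem isHomogeneousOp_iff [CharZero K] [DecidableEq ι] {m d : ℕ}
    {θ : End K (MvPolynomial ι K)} :
    IsHomogeneousOp K m d θ ↔ θ ∈ diffOps K ι m ∧
      ∀ a : ι → ℕ, ∑ i, a i = m → (θ (monomialOf a)).IsHomogeneous d := by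
  constructor
  · rintro ⟨f, hf, rfl⟩
    refine ⟨sum_mem fun a ha => Submodule.smul_mem _ _
      (partialPow_mem_diffOps (Finset.mem_piAntidiag.1 ha).1), fun b hb => ?_⟩
    rw [LinearMap.sum_apply]
    refine IsHomogeneous.sum _ _ _ fun a ha => ?_
    rw [LinearMap.smul_apply, partialPow_monomialOf (Finset.mem_piAntidiag.1 ha).1 hb.le]
    split_ifs
    · have h := (hf a).mul (isHomogeneous_C ι (∏ i, ((a i).factorial : K)))
      rwa [add_zero] at h
    · rw [smul_zero]
      exact isHomogeneous_zero _ _ _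
  · rintro ⟨h, hd⟩
    -- The definition asks every `f a` to be homogeneous, also those outside `|a| = m`, so the
    -- latter are set to zero.
    refine ⟨fun a => if ∑ i, a i = m then C (∏ i, ((a i).factorial : K))⁻¹ * θ (monomialOf a)
      else 0, fun a => ?_, ?_⟩
    · dsimp only
      split_ifs with ha
      · have h := (isHomogeneous_C ι (∏ i, ((a i).factorial : K))⁻¹).mul (hd a ha)
        rwa [zero_add] at h
      · exact isHomogeneous_zero _ _ _
    · refine (symbolProj_eq_self h).symm.trans ?_
      rw [symbolProj_apply]
      refine Finset.sum_congr rfl fun a ha => ?_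
      dsimp only
      rw [if_pos (Finset.mem_piAntidiag.1 ha).1]

theorem isHomogeneousOp_zero [DecidableEq ι] (m d : ℕ) :
    IsHomogeneousOp K m d (0 : End K (MvPolynomial ι K)) :=
  ⟨0, fun _ => isHomogeneous_zero _ _ _, by simp⟩

theorem IsHomogeneousOp.add [DecidableEq ι] {m d : ℕ} {θ η : End K (MvPolynomial ι K)}
    (hθ : IsHomogeneousOp K m d θ) (hη : IsHomogeneousOp K m d η) :
    IsHomogeneousOp K m d (θ + η) := by
  obtain ⟨f, hf, rfl⟩ := hθ
  obtain ⟨g, hg, rfl⟩ := hη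
  exact ⟨f + g, fun a => (hf a).add (hg a), by simp [add_smul, Finset.sum_add_distrib]⟩

theorem IsHomogeneousOp.sum [DecidableEq ι] {m d : ℕ} {κ : Type*} (s : Finset κ)
    (θ : κ → End K (MvPolynomial ι K)) (h : ∀ k ∈ s, IsHomogeneousOp K m d (θ k)) :
    IsHomogeneousOp K m d (∑ k ∈ s, θ k) :=
  Finset.sum_induction _ _ (fun _ _ => IsHomogeneousOp.add) (isHomogeneousOp_zero m d) h

/-- Stated for all of `constOps` because products of the `∂^a`, `∂^b` of two factors become
`K`-combinations of several `∂^c` in the unrelated coordinates of the product. -/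
theorem isHomogeneousOp_smul_const [DecidableEq ι] {m d : ℕ} {f : MvPolynomial ι K}
    (hf : f.IsHomogeneous d) {θ : End K (MvPolynomial ι K)} (hθ : θ ∈ constOps K ι m) :
    IsHomogeneousOp K m d (f • θ) := by
  induction hθ using Submodule.span_induction with
  | mem x hx =>
    obtain ⟨a, h, rfl⟩ := hx
    refine ⟨Pi.single a f, fun b => ?_, ?_⟩
    · rcases eq_or_ne b a with rfl | hb
      · simpa using hf
      · simpa [hb] using isHomogeneous_zero _ _ _
    · rw [Finset.sum_eq_single a]
      · simp
      · intro b _ hb; simp [hb]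
      · intro h'; exact absurd (Finset.mem_piAntidiag.2 ⟨h, by simp⟩) h'
  | zero => simpa using isHomogeneousOp_zero m d
  | add x y _ _ hx hy => rw [smul_add]; exact hx.add hy
  | smul c x _ hx =>
    obtain ⟨g, hg, h⟩ := hx
    refine ⟨fun a => C c * g a, fun a => ?_, ?_⟩
    · have h := (isHomogeneous_C ι c).mul (hg a)
      rwa [zero_add] at h
    have : f • c • x = (C c : MvPolynomial ι K) • (f • x) := by
      refine LinearMap.ext fun p => ?_
      simp [MvPolynomial.smul_eq_C_mul, mul_left_comm]
    rw [this, h, Finset.smul_sum]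
    simp [smul_smul]

end OneRing

end CentralArrangement

namespace CentralArrangement

/-! ### Graded modules over a polynomial ring: homogeneous bases and their degrees -/

section Graded

variable {K ι : Type*} [Field K]

section Components

attribute [local instance] MvPolynomial.gradedAlgebra

theorem homogeneousComponent_mul_of_left {k : ℕ} {f : MvPolynomial ι K}
    (hf : f.IsHomogeneous k) (g : MvPolynomial ι K) (n : ℕ) :
    homogeneousComponent n (f * g) =
      if k ≤ n then f * homogeneousComponent (n - k) g else 0 := by
  have h := DirectSum.coe_decompose_mul_of_left_mem (𝒜 := homogeneousSubmodule ι K) (b := g) n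
    ((mem_homogeneousSubmodule k f).2 hf)
  have e : ∀ (p : MvPolynomial ι K) (j : ℕ),
      (DirectSum.decompose (homogeneousSubmodule ι K) p j : MvPolynomial ι K) =
        homogeneousComponent j p := fun p j => decomposition.decompose'_apply p j
  rwa [e, e] at h

end Components

theorem homogeneousComponent_mul_of_right {k : ℕ} {g : MvPolynomial ι K}
    (hg : g.IsHomogeneous k) (f : MvPolynomial ι K) (n : ℕ) :
    homogeneousComponent n (f * g) =
      if k ≤ n then homogeneousComponent (n - k) f * g else 0 := by
  rw [mul_comm, homogeneousComponent_mul_of_left hg]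
  simp only [mul_comm]

theorem sum_homogeneousComponent_of_lt {p : MvPolynomial ι K} {D : ℕ} (h : p.totalDegree < D) :
    ∑ d ∈ Finset.range D, homogeneousComponent d p = p := by
  conv_rhs => rw [← sum_homogeneousComponent p]
  symm
  refine Finset.sum_subset (by simpa using h) fun d _ hd => ?_
  exact homogeneousComponent_eq_zero _ _ (by simpa using hd)

variable {σ N : Type*} [AddCommGroup N] [Module (MvPolynomial ι K) N]

/-- Homogeneity of degree `d` of an element of a module with respect to polynomial coordinates. -/
def CoordHomogeneous (c : N →ₗ[MvPolynomial ι K] (σ → MvPolynomial ι K)) (d : ℕ) (n : N) : Prop :=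
  ∀ s, (c n s).IsHomogeneous d

/-- A module is closed under homogeneous components with respect to polynomial coordinates. -/
def CoordGraded (c : N →ₗ[MvPolynomial ι K] (σ → MvPolynomial ι K)) : Prop :=
  ∀ (n : N) (d : ℕ), ∃ n', ∀ s, c n' s = homogeneousComponent d (c n s)

variable {c : N →ₗ[MvPolynomial ι K] (σ → MvPolynomial ι K)}

theorem exists_finset_homogeneous_generators [Fintype σ] [Module.Finite (MvPolynomial ι K) N]
    (hc : Function.Injective c) (hgr : CoordGraded c) :
    ∃ G : Finset N, (∀ g ∈ G, ∃ d, CoordHomogeneous c d g) ∧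
      Submodule.span (MvPolynomial ι K) (G : Set N) = ⊤ := by
  classical
  obtain ⟨G₀, hG₀⟩ := Module.Finite.fg_top (R := MvPolynomial ι K) (M := N)
  choose comp hcomp using hgr
  -- Exceeds the degree of every coordinate of every generator, so the components below `D` sum to
  -- the generator.
  let D : ℕ := (∑ g ∈ G₀, ∑ s, (c g s).totalDegree) + 1
  refine ⟨(G₀ ×ˢ Finset.range D).image (fun p => comp p.1 p.2), ?_, ?_⟩
  · intro g hg
    obtain ⟨p, _, rfl⟩ := Finset.mem_image.1 hg
    refine ⟨p.2, fun s => ?_⟩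
    rw [hcomp]
    exact homogeneousComponent_isHomogeneous _ _
  · rw [eq_top_iff, ← hG₀, Submodule.span_le]
    intro g hg
    have hsum : g = ∑ d ∈ Finset.range D, comp g d := by
      apply hc
      funext s
      rw [map_sum, Finset.sum_apply]
      simp only [hcomp]
      refine (sum_homogeneousComponent_of_lt ?_).symm
      refine Nat.lt_succ_of_le ?_
      exact (Finset.single_le_sum (f := fun s => (c g s).totalDegree) (fun _ _ => Nat.zero_le _)
        (Finset.mem_univ s)).trans (Finset.single_le_sum
          (f := fun g => ∑ s, (c g s).totalDegree) (fun _ _ => Nat.zero_le _) hg)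
    rw [hsum]
    refine sum_mem fun d hd => Submodule.subset_span ?_
    exact Finset.mem_coe.2 (Finset.mem_image_of_mem _ (Finset.mk_mem_product hg hd))

theorem exists_minimal_homogeneous_generators [Fintype σ] [Module.Finite (MvPolynomial ι K) N]
    (hc : Function.Injective c) (hgr : CoordGraded c) :
    ∃ G : Finset N, (∀ g ∈ G, ∃ d, CoordHomogeneous c d g) ∧
      Submodule.span (MvPolynomial ι K) (G : Set N) = ⊤ ∧
      ∀ g ∈ G, g ∉ Submodule.span (MvPolynomial ι K) ((G : Set N) \ {g}) := by
  classical
  let P : ℕ → Prop := fun n => ∃ G : Finset N, G.card = n ∧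
    (∀ g ∈ G, ∃ d, CoordHomogeneous c d g) ∧
      Submodule.span (MvPolynomial ι K) (G : Set N) = ⊤
  have hP : ∃ n, P n := by
    obtain ⟨G, h⟩ := exists_finset_homogeneous_generators hc hgr
    exact ⟨_, G, rfl, h⟩
  obtain ⟨G, hcard, hG, hspan⟩ := Nat.find_spec hP
  refine ⟨G, hG, hspan, fun g hg hmem => ?_⟩
  refine Nat.find_min hP (m := (G.erase g).card) ?_
    ⟨G.erase g, rfl, fun x hx => hG x (Finset.mem_of_mem_erase hx), ?_⟩
  · rw [← hcard]
    exact Finset.card_erase_lt_of_mem hg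
  · rw [eq_top_iff, ← hspan, Submodule.span_le]
    intro x hx
    rw [Finset.coe_erase]
    by_cases h : x = g
    · rw [h]; exact hmem
    · exact Submodule.subset_span ⟨hx, h⟩

/-- In a relation between minimal homogeneous generators no coefficient has a constant term. -/
theorem constantCoeff_eq_zero_of_relation {κ : Type*} [Fintype κ] (hc : Function.Injective c)
    {v : κ → N} {d : κ → ℕ} (hv : ∀ j, CoordHomogeneous c (d j) (v j))
    (hmin : ∀ j, v j ∉ Submodule.span (MvPolynomial ι K) (v '' {j}ᶜ))
    {f : κ → MvPolynomial ι K} (hf : ∑ j, f j • v j = 0) (j : κ) :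
    constantCoeff (f j) = 0 := by
  classical
  by_contra hne
  -- The part of the relation in degree `d j`: the coefficient of `v j` becomes the constant term of
  -- `f j`. If that scalar were nonzero, `v j` would be a combination of the other generators. The
  -- `if` guards against truncated subtraction.
  have hrel : ∑ k, (if d k ≤ d j then homogeneousComponent (d j - d k) (f k) else 0) • v k = 0 := by
    apply hc
    funext s
    have h1 := congrArg (homogeneousComponent (d j)) (congrFun (congrArg c hf) s)
    simp only [map_sum, map_smul, Finset.sum_apply, Pi.smul_apply, smul_eq_mul, map_zero,
      Pi.zero_apply] at h1 ⊢
    refine Eq.trans (Finset.sum_congr rfl fun k _ => ?_) h1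
    rw [homogeneousComponent_mul_of_right (hv k s), ite_mul, zero_mul]
  rw [← Finset.add_sum_erase _ _ (Finset.mem_univ j), if_pos le_rfl, Nat.sub_self,
    homogeneousComponent_zero, ← constantCoeff_eq] at hrel
  apply hmin j
  have h2 : v j = (C (constantCoeff (f j))⁻¹ : MvPolynomial ι K) •
      -(∑ k ∈ Finset.univ.erase j,
        (if d k ≤ d j then homogeneousComponent (d j - d k) (f k) else 0) • v k) := by
    rw [← eq_neg_of_add_eq_zero_left hrel, smul_smul, ← C_mul, inv_mul_cancel₀ hne, C_1, one_smul]
  rw [h2]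
  refine Submodule.smul_mem _ _ (neg_mem (sum_mem fun k hk => Submodule.smul_mem _ _
    (Submodule.subset_span ⟨k, ?_, rfl⟩)))
  exact Finset.ne_of_mem_erase hk

/-- A finitely generated graded projective module over a polynomial ring has a homogeneous
basis. -/
theorem exists_homogeneous_basis_of_projective [Fintype σ] [Finite ι]
    [Module.Finite (MvPolynomial ι K) N]
    [Module.Projective (MvPolynomial ι K) N] (hc : Function.Injective c) (hgr : CoordGraded c) :
    ∃ (n : ℕ) (b : Basis (Fin n) (MvPolynomial ι K) N) (d : Fin n → ℕ),
      ∀ j, CoordHomogeneous c (d j) (b j) := by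
  classical
  obtain ⟨G, hG, hspan, hmin⟩ := exists_minimal_homogeneous_generators hc hgr
  choose! deg hdeg using hG
  let v : G → N := Subtype.val
  have hv : ∀ j, CoordHomogeneous c (deg (v j)) (v j) := fun j => hdeg j j.2
  have hvmin : ∀ j, v j ∉ Submodule.span (MvPolynomial ι K) (v '' {j}ᶜ) := by
    intro j hj
    refine hmin j j.2 (Submodule.span_mono ?_ hj)
    rintro _ ⟨k, hk, rfl⟩
    exact ⟨k.2, fun h => hk (Subtype.ext h)⟩
  have hvspan : ⊤ ≤ Submodule.span (MvPolynomial ι K) (Set.range v) := by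
    rw [Subtype.range_coe_subtype]
    exact hspan.ge
  let φ := Fintype.linearCombination (MvPolynomial ι K) v
  have hφ : LinearMap.range φ = ⊤ := by
    rw [Fintype.range_linearCombination]
    exact top_le_iff.1 hvspan
  -- Projectivity splits the presentation by minimal homogeneous generators.
  obtain ⟨τ, hτ⟩ := φ.exists_rightInverse_of_surjective hφ
  let 𝔪 : Ideal (MvPolynomial ι K) := RingHom.ker (constantCoeff (σ := ι) (R := K))
  -- For `f` in the kernel, `f = ∑ f_j (e_j - τ φ e_j)`: each bracket lies in the kernel, and each
  -- `f_j` lies in `𝔪` by minimality of the generators.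
  have hker : LinearMap.ker φ ≤ 𝔪 • LinearMap.ker φ := by
    intro f hf
    have hf0 : φ f = 0 := hf
    have hrepr : f = ∑ j, f j • (Pi.single j 1 - τ (φ (Pi.single j 1))) := by
      have h1 : f = ∑ j, f j • (Pi.single j 1 : G → MvPolynomial ι K) := by
        funext k
        simp [Finset.sum_apply, Pi.single_apply]
      have h2 : ∑ j, f j • τ (φ (Pi.single j 1)) = τ (φ f) := by
        conv_rhs => rw [h1]
        simp only [map_sum, map_smul]
      simp only [smul_sub, Finset.sum_sub_distrib]
      rw [h2, hf0, map_zero, sub_zero, ← h1]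
    rw [hrepr]
    refine sum_mem fun j _ => Submodule.smul_mem_smul ?_ ?_
    · exact constantCoeff_eq_zero_of_relation hc hv hvmin
        (by simpa [φ, Fintype.linearCombination_apply] using hf0) j
    · rw [LinearMap.mem_ker, map_sub]
      have := LinearMap.congr_fun hτ (φ (Pi.single j 1))
      simp only [LinearMap.comp_apply, LinearMap.id_apply] at this
      rw [this, sub_self]
  -- Nakayama's lemma in determinant form: some `r ≡ 1` modulo `𝔪` annihilates the kernel. Such an
  -- `r` is nonzero and the kernel is torsion-free, so the kernel is zero without localizing at `𝔪`.
  obtain ⟨r, hr, hr0⟩ := Submodule.exists_sub_one_mem_and_smul_eq_zero_of_fg_of_le_smul 𝔪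
    (LinearMap.ker φ) (IsNoetherian.noetherian _) hker
  have hrne : r ≠ 0 := by
    rintro rfl
    simp [𝔪, RingHom.mem_ker] at hr
  have hli : LinearIndependent (MvPolynomial ι K) v := by
    rw [Fintype.linearIndependent_iff]
    intro f hf j
    have hfker : f ∈ LinearMap.ker φ := by
      rw [LinearMap.mem_ker]
      simpa [φ, Fintype.linearCombination_apply] using hf
    have := congrFun (hr0 f hfker) j
    exact (mul_eq_zero.1 (by simpa using this)).resolve_left hrne
  refine ⟨Fintype.card G, (Basis.mk hli hvspan).reindex (Fintype.equivFin G),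
    fun j => deg (v ((Fintype.equivFin G).symm j)), fun j => ?_⟩
  rw [Basis.reindex_apply, Basis.mk_apply]
  exact hv _

/-- The degrees of a homogeneous basis are unique. -/
theorem degrees_eq_of_homogeneous_bases {κ κ' : Type*} [Fintype κ] [Fintype κ']
    (hc : Function.Injective c)
    (b : Basis κ (MvPolynomial ι K) N) (b' : Basis κ' (MvPolynomial ι K) N)
    {d : κ → ℕ} {d' : κ' → ℕ} (hb : ∀ j, CoordHomogeneous c (d j) (b j))
    (hb' : ∀ j, CoordHomogeneous c (d' j) (b' j)) :
    Finset.univ.val.map d = Finset.univ.val.map d' := by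
  classical
  let e : κ ≃ κ' := b.indexEquiv b'
  let b'' := b'.reindex e.symm
  let d'' := fun j => d' (e j)
  have hb'' : ∀ j, CoordHomogeneous c (d'' j) (b'' j) := by
    intro j
    simpa [b'', d''] using hb' (e j)
  have hd'' : Finset.univ.val.map d'' = Finset.univ.val.map d' := by
    conv_rhs => rw [← Finset.map_univ_equiv e, Finset.map_val, Multiset.map_map]
    rfl
  rw [← hd'']
  -- By homogeneity the `(i, j)` entry of the base change is homogeneous of degree `d'' j - d i`, or
  -- zero, so a nonzero constant term forces equal degrees.
  have hdeg : ∀ i j, constantCoeff (b.toMatrix b'' i j) ≠ 0 → d i = d'' j := by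
    intro i j hne
    have hrel : b'' j = ∑ k, (if d k ≤ d'' j then
        homogeneousComponent (d'' j - d k) (b.repr (b'' j) k) else 0) • b k := by
      apply hc
      funext s
      have h1 : homogeneousComponent (d'' j) (c (b'' j) s) = c (b'' j) s :=
        homogeneousComponent_eq_self (hb'' j s)
      rw [← h1]
      conv_lhs => rw [← b.sum_repr (b'' j)]
      simp only [map_sum, map_smul, Finset.sum_apply, Pi.smul_apply, smul_eq_mul]
      refine Finset.sum_congr rfl fun k _ => ?_
      rw [homogeneousComponent_mul_of_right (hb k s)]
      split_ifs <;> simp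
    have h2 := congrArg (fun n => b.repr n i) hrel
    simp only [map_sum, map_smul, b.repr_self, Finsupp.coe_finsetSum, Finset.sum_apply,
      Finsupp.smul_apply, Finsupp.single_apply, smul_eq_mul, mul_ite, mul_one, mul_zero,
      Finset.sum_ite_eq', Finset.mem_univ, if_true] at h2
    rw [Basis.toMatrix_apply, h2] at hne
    split_ifs at hne with hle
    · by_contra hlt
      apply hne
      rw [constantCoeff_eq, coeff_homogeneousComponent, if_neg]
      simp only [map_zero]
      omega
    · simp at hne
  have hdet : (constantCoeff (σ := ι) (R := K)) (b.toMatrix b'').det ≠ 0 := by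
    have hu : IsUnit (b.toMatrix b'').det := by
      refine IsUnit.of_mul_eq_one (b''.toMatrix b).det ?_
      rw [← Matrix.det_mul, Basis.toMatrix_mul_toMatrix_flip, Matrix.det_one]
    exact (hu.map constantCoeff).ne_zero
  rw [Matrix.det_apply, map_sum] at hdet
  -- The constant term of the invertible determinant is nonzero, so some term of the Leibniz
  -- expansion survives; its permutation matches the two lists of degrees.
  obtain ⟨π, _, hπ⟩ := Finset.exists_ne_zero_of_sum_ne_zero hdet
  have hπ' : ∀ j, d (π j) = d'' j := by
    intro j
    apply hdeg
    intro h0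
    apply hπ
    rw [Units.smul_def, map_zsmul, map_prod, Finset.prod_eq_zero (Finset.mem_univ j) h0, smul_zero]
  have h3 := congrArg (fun s : Finset κ => s.val.map d) (Finset.map_univ_equiv π)
  simp only [Finset.map_val, Multiset.map_map, Function.comp_def, Equiv.coe_toEmbedding, hπ'] at h3
  exact h3.symm

end Graded

/-! ### Operators preserving a principal ideal, and their grading -/

section PreservingOps

variable {K ι : Type*} [Field K] [Fintype ι]

/-- The operators in `D^(m)(S)` that preserve the principal ideal `QS`. -/
noncomputable def preservingOps (Q : MvPolynomial ι K) (m : ℕ) :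
    Submodule (MvPolynomial ι K) (End K (MvPolynomial ι K)) where
  carrier := {θ | θ ∈ diffOps K ι m ∧ ∀ p, Q ∣ θ (Q * p)}
  zero_mem' := ⟨Submodule.zero_mem _, fun _ => dvd_zero _⟩
  add_mem' := fun hθ hη => ⟨Submodule.add_mem _ hθ.1 hη.1, fun p => dvd_add (hθ.2 p) (hη.2 p)⟩
  smul_mem' := fun f _ hθ => ⟨Submodule.smul_mem _ f hθ.1, fun p => (hθ.2 p).mul_left f⟩

theorem mem_preservingOps {Q : MvPolynomial ι K} {m : ℕ} {θ : End K (MvPolynomial ι K)} :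
    θ ∈ preservingOps Q m ↔ θ ∈ diffOps K ι m ∧ ∀ p, Q ∣ θ (Q * p) := Iff.rfl

theorem preservingOps_le_diffOps (Q : MvPolynomial ι K) (m : ℕ) :
    preservingOps Q m ≤ diffOps K ι m := fun _ h => h.1

theorem preservingOps_congr {Q Q' : MvPolynomial ι K} (h : Associated Q Q') (m : ℕ) :
    preservingOps Q m = preservingOps Q' m := by
  obtain ⟨u, rfl⟩ := h
  ext θ
  rw [mem_preservingOps, mem_preservingOps]
  refine and_congr_right fun _ => ⟨fun h p => ?_, fun h p => ?_⟩
  · rw [Units.mul_right_dvd, mul_assoc]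
    exact h _
  · have := h (↑u⁻¹ * p)
    rwa [Units.mul_right_dvd, mul_assoc, Units.mul_inv_cancel_left] at this

theorem smul_mem_preservingOps (Q : MvPolynomial ι K) {m : ℕ} {θ : End K (MvPolynomial ι K)}
    (hθ : θ ∈ diffOps K ι m) : Q • θ ∈ preservingOps Q m :=
  ⟨Submodule.smul_mem _ _ hθ, fun _ => Dvd.intro _ rfl⟩

/-- The witness is `Q ∂_i^m`. A variable must exist: this is where positive dimension of the factors
enters. -/
theorem exists_ne_zero_mem_preservingOps [CharZero K] [Nonempty ι] {Q : MvPolynomial ι K}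
    (hQ : Q ≠ 0) (m : ℕ) : ∃ θ ∈ preservingOps Q m, θ ≠ 0 := by
  classical
  obtain ⟨i⟩ := ‹Nonempty ι›
  let a : ι → ℕ := Pi.single i m
  have ha : ∑ j, a j = m := by simp [a]
  refine ⟨Q • partialPow K a, smul_mem_preservingOps Q (partialPow_mem_diffOps ha), fun h => ?_⟩
  have h1 := LinearMap.congr_fun h (monomialOf a)
  rw [LinearMap.smul_apply, partialPow_monomialOf ha ha.le, if_pos rfl, LinearMap.zero_apply,
    smul_eq_mul, mul_eq_zero, C_eq_zero] at h1
  exact h1.elim hQ (prod_factorial_ne_zero a)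

section Coordinates

variable [DecidableEq ι]

/-- The values of an operator on the monomials of degree `m`, as coordinates. -/
noncomputable def opCoord (Q : MvPolynomial ι K) (m : ℕ) :
    preservingOps Q m →ₗ[MvPolynomial ι K]
      ((Finset.piAntidiag (Finset.univ : Finset ι) m) → MvPolynomial ι K) where
  toFun θ a := θ.1 (monomialOf a.1)
  map_add' _ _ := rfl
  map_smul' _ _ := rfl

theorem opCoord_injective [CharZero K] (Q : MvPolynomial ι K) (m : ℕ) :
    Function.Injective (opCoord Q m) := by
  intro θ η h
  apply Subtype.ext
  rw [← symbolProj_eq_self θ.2.1, ← symbolProj_eq_self η.2.1, symbolProj_apply, symbolProj_apply]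
  refine Finset.sum_congr rfl fun a ha => ?_
  have h1 : θ.1 (monomialOf a) = η.1 (monomialOf a) := congrFun h ⟨a, ha⟩
  rw [h1]

theorem coordHomogeneous_opCoord_iff [CharZero K] {Q : MvPolynomial ι K} {m d : ℕ}
    {θ : preservingOps Q m} :
    CoordHomogeneous (opCoord Q m) d θ ↔ IsHomogeneousOp K m d θ.1 := by
  rw [isHomogeneousOp_iff]
  constructor
  · intro h
    exact ⟨θ.2.1, fun a ha => h ⟨a, by simpa using ha⟩⟩
  · intro h a
    exact h.2 a.1 (Finset.mem_piAntidiag.1 a.2).1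

instance finite_preservingOps [CharZero K] (Q : MvPolynomial ι K) (m : ℕ) :
    Module.Finite (MvPolynomial ι K) (preservingOps Q m) := by
  have : IsNoetherian (MvPolynomial ι K) (preservingOps Q m) :=
    isNoetherian_of_injective _ (opCoord_injective Q m)
  infer_instance

/-- The vanishing clause is carried along because `n - m` truncates to zero when `n < m`. -/
theorem partialPow_isHomogeneous (m : ℕ) : ∀ (a : ι → ℕ), ∑ i, a i = m → ∀ {p : MvPolynomial ι K}
    {n : ℕ}, p.IsHomogeneous n → (partialPow K a p).IsHomogeneous (n - m) ∧
      (n < m → partialPow K a p = 0) := by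
  induction m with
  | zero =>
    intro a ha p n hp
    have ha0 : a = 0 := by
      funext i
      exact (Finset.sum_eq_zero_iff.1 ha) i (Finset.mem_univ i)
    subst ha0
    rw [partialPow_zero]
    exact ⟨hp, fun h => absurd h (Nat.not_lt_zero _)⟩
  | succ m ih =>
    intro a ha p n hp
    obtain ⟨i, b, rfl, hb⟩ := exists_eq_single_add ha
    rw [partialPow_add, partialPow_commute, partialPow_single]
    change (partialPow K b (pderiv i p)).IsHomogeneous _ ∧ (_ → partialPow K b (pderiv i p) = 0)
    obtain ⟨h1, h2⟩ := ih b hb (hp.pderiv (i := i))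
    refine ⟨by rwa [show n - (m + 1) = n - 1 - m by omega], fun hn => ?_⟩
    rcases Nat.eq_zero_or_pos n with rfl | hpos
    · rw [← homogeneousComponent_eq_self hp, homogeneousComponent_zero, pderiv_C, map_zero]
    · exact h2 (by omega)

/-- The homogeneous component of degree `d` of an operator. -/
noncomputable def opComponent (m d : ℕ) (θ : End K (MvPolynomial ι K)) :
    End K (MvPolynomial ι K) :=
  ∑ a ∈ Finset.piAntidiag Finset.univ m,
    homogeneousComponent d (C (∏ i, ((a i).factorial : K))⁻¹ * θ (monomialOf a)) • partialPow K a

/-- Each `∂^a` lowers the degree by exactly `m`, so on a form of degree `n` taking the component of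
the coefficients amounts to taking the component of the value in degree `d + (n - m)`. -/
theorem opComponent_apply_homogeneous [CharZero K] {m : ℕ} (d : ℕ) {θ : End K (MvPolynomial ι K)}
    (hθ : θ ∈ diffOps K ι m) {p : MvPolynomial ι K} {n : ℕ} (hp : p.IsHomogeneous n) :
    opComponent m d θ p = if m ≤ n then homogeneousComponent (d + (n - m)) (θ p) else 0 := by
  have h : θ p = ∑ a ∈ Finset.piAntidiag Finset.univ m,
      (C (∏ i, ((a i).factorial : K))⁻¹ * θ (monomialOf a)) * partialPow K a p := by
    conv_lhs => rw [← symbolProj_eq_self hθ, symbolProj_apply, LinearMap.sum_apply]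
    rfl
  rw [opComponent, LinearMap.sum_apply]
  split_ifs with hmn
  · rw [h, map_sum]
    refine Finset.sum_congr rfl fun a ha => ?_
    rw [homogeneousComponent_mul_of_right
      (partialPow_isHomogeneous m a (Finset.mem_piAntidiag.1 ha).1 hp).1, if_pos (by omega),
      Nat.add_sub_cancel, LinearMap.smul_apply, smul_eq_mul]
  · refine Finset.sum_eq_zero fun a ha => ?_
    rw [LinearMap.smul_apply,
      (partialPow_isHomogeneous m a (Finset.mem_piAntidiag.1 ha).1 hp).2 (by omega), smul_zero]

/-- For a form `p` the value at `Q * p` is a homogeneous component of some `Q * g`, or zero; as `Q`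
is homogeneous, such a component is still divisible by `Q`. -/
theorem opComponent_mem [CharZero K] {Q : MvPolynomial ι K} {r : ℕ} (hQ : Q.IsHomogeneous r)
    {m : ℕ} (d : ℕ) {θ : End K (MvPolynomial ι K)} (hθ : θ ∈ preservingOps Q m) :
    opComponent m d θ ∈ preservingOps Q m := by
  refine ⟨sum_mem fun a ha => Submodule.smul_mem _ _
    (partialPow_mem_diffOps (Finset.mem_piAntidiag.1 ha).1), fun p => ?_⟩
  rw [← sum_homogeneousComponent p, Finset.mul_sum, map_sum]
  refine Finset.dvd_sum fun n _ => ?_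
  rw [opComponent_apply_homogeneous d hθ.1 (hQ.mul (homogeneousComponent_isHomogeneous n p))]
  split_ifs
  · obtain ⟨g, hg⟩ := hθ.2 (homogeneousComponent n p)
    rw [hg, homogeneousComponent_mul_of_left hQ]
    split_ifs
    · exact Dvd.intro _ rfl
    · exact dvd_zero _
  · exact dvd_zero _

theorem coordGraded_opCoord [CharZero K] {Q : MvPolynomial ι K} {r : ℕ} (hQ : Q.IsHomogeneous r)
    (m : ℕ) : CoordGraded (N := preservingOps Q m) (opCoord Q m) := by
  intro θ d
  refine ⟨⟨opComponent m d θ.1, opComponent_mem hQ d θ.2⟩, fun a => ?_⟩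
  have ha := (Finset.mem_piAntidiag.1 a.2).1
  change opComponent m d θ.1 (monomialOf a.1) = homogeneousComponent d (θ.1 (monomialOf a.1))
  rw [opComponent_apply_homogeneous d θ.2.1 (monomialOf_degree ha), if_pos le_rfl, Nat.sub_self,
    add_zero]

end Coordinates

end PreservingOps

end CentralArrangement

namespace CentralArrangement

/-! ### Operators on a tensor product -/

section Box

variable {K A₁ A₂ B : Type*} [Field K] [CommRing A₁] [Algebra K A₁] [CommRing A₂] [Algebra K A₂]
  [CommRing B] [Algebra K B]

/-- The operator on `B ≃ A₁ ⊗ A₂` induced by operators on the two factors. -/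
noncomputable def box (Ψ : A₁ ⊗[K] A₂ ≃ₐ[K] B) : End K A₁ →ₗ[K] End K A₂ →ₗ[K] End K B :=
  LinearMap.mk₂ K (fun u w => Ψ.toLinearEquiv.conj (TensorProduct.map u w))
    (fun u u' w => by rw [TensorProduct.map_add_left, map_add])
    (fun c u w => by rw [TensorProduct.map_smul_left, map_smul])
    (fun u w w' => by rw [TensorProduct.map_add_right, map_add])
    (fun c u w => by rw [TensorProduct.map_smul_right, map_smul])

/-- Exchange of the two tensor factors. -/
noncomputable def swapFactors (Ψ : A₁ ⊗[K] A₂ ≃ₐ[K] B) : A₂ ⊗[K] A₁ ≃ₐ[K] B :=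
  (Algebra.TensorProduct.comm K A₂ A₁).trans Ψ

variable (Ψ : A₁ ⊗[K] A₂ ≃ₐ[K] B)

@[simp] theorem swapFactors_tmul (p : A₁) (q : A₂) : swapFactors Ψ (q ⊗ₜ p) = Ψ (p ⊗ₜ q) := by
  simp [swapFactors]

@[simp] theorem box_apply_tmul (u : End K A₁) (w : End K A₂) (p : A₁) (q : A₂) :
    box Ψ u w (Ψ (p ⊗ₜ q)) = Ψ (u p ⊗ₜ w q) := by
  simp [box, LinearEquiv.conj_apply]

theorem tensorEquiv_induction {P : B → Prop} (htmul : ∀ p q, P (Ψ (p ⊗ₜ q)))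
    (hadd : ∀ a b, P a → P b → P (a + b)) (b : B) : P b := by
  obtain ⟨t, rfl⟩ := Ψ.surjective b
  induction t using TensorProduct.induction_on with
  | zero => simpa using htmul 0 0
  | tmul p q => exact htmul p q
  | add a b ha hb => rw [map_add]; exact hadd _ _ ha hb

theorem tensorEquiv_linearMap_ext {M : Type*} [AddCommGroup M] [Module K M] {f g : B →ₗ[K] M}
    (h : ∀ p q, f (Ψ (p ⊗ₜ q)) = g (Ψ (p ⊗ₜ q))) : f = g :=
  LinearMap.ext fun b => tensorEquiv_induction Ψ (P := fun b => f b = g b) h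
    (fun a b ha hb => by rw [map_add, map_add, ha, hb]) b

/-- Lets statements proved for one factor be transferred to the other. -/
theorem box_swapFactors (u : End K A₁) (w : End K A₂) :
    box (swapFactors Ψ) w u = box Ψ u w := by
  refine tensorEquiv_linearMap_ext Ψ fun p q => ?_
  rw [box_apply_tmul, ← swapFactors_tmul, box_apply_tmul, swapFactors_tmul]

theorem smul_box (f : A₁) (g : A₂) (u : End K A₁) (w : End K A₂) :
    Ψ (f ⊗ₜ g) • box Ψ u w = box Ψ (f • u) (g • w) := by
  refine tensorEquiv_linearMap_ext Ψ fun p q => ?_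
  rw [LinearMap.smul_apply, box_apply_tmul, box_apply_tmul, smul_eq_mul, ← map_mul,
    Algebra.TensorProduct.tmul_mul_tmul]
  rfl

theorem box_mul_box (u u' : End K A₁) (w w' : End K A₂) :
    box Ψ u w * box Ψ u' w' = box Ψ (u * u') (w * w') := by
  refine tensorEquiv_linearMap_ext Ψ fun p q => ?_
  simp [Module.End.mul_apply]

theorem box_one_one : box Ψ 1 1 = 1 := by
  refine tensorEquiv_linearMap_ext Ψ fun p q => ?_
  simp

/-- A derivation of the first factor extended to the tensor product. -/
noncomputable def boxDerivation (δ : Derivation K A₁ A₁) : Derivation K B B :=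
  Derivation.mk' (box Ψ δ.toLinearMap 1) fun a b => by
    induction a using tensorEquiv_induction Ψ with
    | htmul p q =>
      induction b using tensorEquiv_induction Ψ with
      | htmul p' q' =>
        rw [← map_mul, Algebra.TensorProduct.tmul_mul_tmul, box_apply_tmul, box_apply_tmul,
          box_apply_tmul, smul_eq_mul, smul_eq_mul, ← map_mul, ← map_mul, ← map_add,
          Algebra.TensorProduct.tmul_mul_tmul, Algebra.TensorProduct.tmul_mul_tmul]
        simp [TensorProduct.add_tmul, mul_comm q' q]
      | hadd a b ha hb => rw [mul_add, map_add, ha, hb, map_add, smul_add, add_smul]; abel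
    | hadd a a' ha ha' => rw [add_mul, map_add, ha, ha', map_add, smul_add, add_smul]; abel

theorem boxDerivation_toLinearMap (δ : Derivation K A₁ A₁) :
    (boxDerivation Ψ δ).toLinearMap = box Ψ δ.toLinearMap 1 := rfl

theorem boxDerivation_apply_tmul (δ : Derivation K A₁ A₁) (p : A₁) (q : A₂) :
    boxDerivation Ψ δ (Ψ (p ⊗ₜ q)) = Ψ (δ p ⊗ₜ q) :=
  box_apply_tmul Ψ δ.toLinearMap 1 p q

/-- Contraction of the second factor by a linear functional. -/
noncomputable def slice (l : A₂ →ₗ[K] K) : B →ₗ[K] A₁ :=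
  (TensorProduct.rid K A₁).toLinearMap ∘ₗ l.lTensor A₁ ∘ₗ Ψ.symm.toLinearMap

@[simp] theorem slice_tmul (l : A₂ →ₗ[K] K) (p : A₁) (q : A₂) :
    slice Ψ l (Ψ (p ⊗ₜ q)) = l q • p := by
  simp [slice]

theorem slice_mul (l : A₂ →ₗ[K] K) (f : A₁) (b : B) :
    slice Ψ l (Ψ (f ⊗ₜ 1) * b) = f * slice Ψ l b := by
  induction b using tensorEquiv_induction Ψ with
  | htmul p q =>
    rw [← map_mul, Algebra.TensorProduct.tmul_mul_tmul, slice_tmul, slice_tmul, one_mul,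
      mul_smul_comm]
  | hadd a b ha hb => rw [mul_add, map_add, ha, hb, map_add, mul_add]

theorem slice_swapFactors_mul (l : A₁ →ₗ[K] K) (g : A₂) (b : B) :
    slice (swapFactors Ψ) l (b * Ψ (1 ⊗ₜ g)) = slice (swapFactors Ψ) l b * g := by
  rw [mul_comm, ← swapFactors_tmul, slice_mul, mul_comm]

/-- The slices by the coordinate functionals of a `K`-basis of `A₂` are the coefficients of `b` in
that basis. -/
theorem eq_zero_of_slice_eq_zero {b : B} (h : ∀ l : A₂ →ₗ[K] K, slice Ψ l b = 0) : b = 0 := by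
  classical
  let 𝒞 := Basis.ofVectorSpace K A₂
  have key : ∀ (b : B) i, TensorProduct.equivFinsuppOfBasisRight (M := A₁) 𝒞 (Ψ.symm b) i =
      slice Ψ (𝒞.coord i) b := by
    intro b i
    induction b using tensorEquiv_induction Ψ with
    | htmul p q => simp
    | hadd a b ha hb => rw [map_add, map_add, map_add, Finsupp.add_apply, ha, hb]
  have h0 : TensorProduct.equivFinsuppOfBasisRight (M := A₁) 𝒞 (Ψ.symm b) = 0 := by
    ext i
    rw [key, h]; rfl
  simpa using h0

/-- A relation is contracted twice, first over the second factor to use independence of `u`, then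
over the first to use independence of `w a`. The `w a` for different `a` need not be jointly
independent. -/
theorem linearIndependent_box {α : Type*} {κ : α → Type*} [Fintype α] [∀ a, Fintype (κ a)]
    {u : α → End K A₁} (hu : LinearIndependent A₁ u) {w : ∀ a, κ a → End K A₂}
    (hw : ∀ a, LinearIndependent A₂ (w a)) :
    LinearIndependent B fun k : Σ a, κ a => box Ψ (u k.1) (w k.1 k.2) := by
  refine Fintype.linearIndependent_iff.2 fun F hF => ?_
  -- Evaluating the relation at `p ⊗ q` and contracting with `l` gives an `A₁`-relation among the `u
  -- a`, as `p` varies with `q` fixed.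
  have h1 : ∀ a q, ∑ s, F ⟨a, s⟩ * Ψ (1 ⊗ₜ w a s q) = 0 := by
    intro a q
    refine eq_zero_of_slice_eq_zero Ψ fun l => ?_
    refine Fintype.linearIndependent_iff.1 hu
      (fun a => slice Ψ l (∑ s, F ⟨a, s⟩ * Ψ (1 ⊗ₜ w a s q))) (LinearMap.ext fun p => ?_) a
    have h2 := congrArg (slice Ψ l) (LinearMap.congr_fun hF (Ψ (p ⊗ₜ q)))
    rw [LinearMap.zero_apply, map_zero, LinearMap.sum_apply, map_sum, Fintype.sum_sigma] at h2
    rw [LinearMap.zero_apply, LinearMap.sum_apply, ← h2]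
    refine Finset.sum_congr rfl fun a _ => ?_
    rw [LinearMap.smul_apply, smul_eq_mul, map_sum, Finset.sum_mul]
    refine Finset.sum_congr rfl fun s _ => ?_
    rw [LinearMap.smul_apply, smul_eq_mul, box_apply_tmul, mul_comm (slice Ψ l _), ← slice_mul,
      mul_left_comm, ← map_mul, Algebra.TensorProduct.tmul_mul_tmul, mul_one, one_mul]
  rintro ⟨a, s⟩
  refine eq_zero_of_slice_eq_zero (swapFactors Ψ) fun l => ?_
  refine Fintype.linearIndependent_iff.1 (hw a) (fun s => slice (swapFactors Ψ) l (F ⟨a, s⟩))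
    (LinearMap.ext fun q => ?_) s
  have h4 := congrArg (slice (swapFactors Ψ) l) (h1 a q)
  rw [map_sum, map_zero] at h4
  rw [LinearMap.sum_apply, LinearMap.zero_apply, ← h4]
  refine Finset.sum_congr rfl fun s _ => ?_
  rw [slice_swapFactors_mul]
  rfl

end Box

section Bilinear

/-- Expands every second argument in a fixed basis and absorbs the scalars into the first, which
stays in `U i`. This is the normal form needed by `dvd_of_sum_box_preserves`. -/
theorem exists_finsupp_of_mem_span_bilinear {K X Y Z I : Type*} [Field K] [AddCommGroup X]
    [Module K X] [AddCommGroup Y] [Module K Y] [AddCommGroup Z] [Module K Z]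
    (β : X →ₗ[K] Y →ₗ[K] Z) (U : I → Submodule K X) (W : I → Submodule K Y) {κ : I → Type*}
    (v : ∀ i, Basis (κ i) K (W i)) {z : Z}
    (hz : z ∈ Submodule.span K {z | ∃ i, ∃ u ∈ U i, ∃ w ∈ W i, z = β u w}) :
    ∃ f : (Σ i, κ i) →₀ X, (∀ k, f k ∈ U k.1) ∧
      (f.sum fun k u => β u (v k.1 k.2)) = z := by
  classical
  let L : ((Σ i, κ i) →₀ X) →ₗ[K] Z :=
    Finsupp.lsum K fun k => β.flip (v k.1 k.2 : Y)
  have hle : Submodule.span K {z | ∃ i, ∃ u ∈ U i, ∃ w ∈ W i, z = β u w} ≤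
      (Finsupp.submodule fun k : Σ i, κ i => U k.1).map L := by
    rw [Submodule.span_le]
    rintro _ ⟨i, u, hu, w, hw, rfl⟩
    have hsum := (v i).linearCombination_repr ⟨w, hw⟩
    rw [Finsupp.linearCombination_apply, Finsupp.sum] at hsum
    have hw' : w = ∑ k ∈ ((v i).repr ⟨w, hw⟩).support,
        (v i).repr ⟨w, hw⟩ k • (v i k : Y) := by
      simpa using (congrArg Subtype.val hsum).symm
    rw [hw', map_sum]
    refine sum_mem fun k _ => ⟨Finsupp.single ⟨i, k⟩ ((v i).repr ⟨w, hw⟩ k • u), ?_, ?_⟩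
    · rw [SetLike.mem_coe, Finsupp.mem_submodule_iff]
      intro k'
      rw [Finsupp.single_apply]
      split_ifs with h
      · subst h
        exact Submodule.smul_mem _ _ hu
      · exact Submodule.zero_mem _
    · simp [L]
  obtain ⟨f, hf, hfz⟩ := hle hz
  refine ⟨f, fun k => (Finsupp.mem_submodule_iff _ _).1 hf k, ?_⟩
  rw [← hfz]
  rfl

end Bilinear

end CentralArrangement

namespace CentralArrangement

/-! ### Differential operators on a product in arbitrary linear coordinates -/

section ProductOps

variable {K ι₁ ι₂ ι : Type*} [Field K]

/-- The isomorphism `S₁ ⊗ S₂ ≃ S` identifies the span of the variables of `S` with the span of the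
variables of both factors. -/
def IsLinearTensorEquiv (Ψ : MvPolynomial ι₁ K ⊗[K] MvPolynomial ι₂ K ≃ₐ[K] MvPolynomial ι K) :
    Prop :=
  Submodule.span K (Set.range (X : ι → MvPolynomial ι K)) =
    Submodule.span K (Set.range fun i : ι₁ => Ψ (X i ⊗ₜ 1)) ⊔
      Submodule.span K (Set.range fun j : ι₂ => Ψ (1 ⊗ₜ X j))

variable {Ψ : MvPolynomial ι₁ K ⊗[K] MvPolynomial ι₂ K ≃ₐ[K] MvPolynomial ι K}

theorem IsLinearTensorEquiv.swap (h : IsLinearTensorEquiv Ψ) :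
    IsLinearTensorEquiv (swapFactors Ψ) := by
  simpa only [IsLinearTensorEquiv, swapFactors_tmul, sup_comm] using h

theorem IsLinearTensorEquiv.left_mem (h : IsLinearTensorEquiv Ψ) (i : ι₁) :
    Ψ (X i ⊗ₜ 1) ∈ Submodule.span K (Set.range (X : ι → MvPolynomial ι K)) := by
  rw [h]
  exact Submodule.mem_sup_left (Submodule.subset_span ⟨i, rfl⟩)

theorem IsLinearTensorEquiv.right_mem (h : IsLinearTensorEquiv Ψ) (j : ι₂) :
    Ψ (1 ⊗ₜ X j) ∈ Submodule.span K (Set.range (X : ι → MvPolynomial ι K)) := by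
  rw [h]
  exact Submodule.mem_sup_right (Submodule.subset_span ⟨j, rfl⟩)

/-- On the first factor `Ψ` is substitution of linear forms for the variables. -/
theorem IsLinearTensorEquiv.isHomogeneous_left (h : IsLinearTensorEquiv Ψ)
    {f : MvPolynomial ι₁ K} {d : ℕ} (hf : f.IsHomogeneous d) : (Ψ (f ⊗ₜ 1)).IsHomogeneous d := by
  have e : (Ψ.toAlgHom.comp Algebra.TensorProduct.includeLeft : MvPolynomial ι₁ K →ₐ[K] _) =
      aeval fun i => Ψ (X i ⊗ₜ 1) := by
    ext1 i
    simp
  have e' : Ψ (f ⊗ₜ 1) = aeval (fun i => Ψ (X i ⊗ₜ 1)) f := by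
    rw [← e]; rfl
  rw [e', ← one_mul d]
  refine hf.aeval _ fun i => ?_
  rw [← mem_homogeneousSubmodule, homogeneousSubmodule_one_eq_span_X]
  exact h.left_mem i

theorem IsLinearTensorEquiv.isHomogeneous_tmul (h : IsLinearTensorEquiv Ψ)
    {f : MvPolynomial ι₁ K} {g : MvPolynomial ι₂ K} {d e : ℕ} (hf : f.IsHomogeneous d)
    (hg : g.IsHomogeneous e) : (Ψ (f ⊗ₜ g)).IsHomogeneous (d + e) := by
  have h1 : Ψ (f ⊗ₜ g) = Ψ (f ⊗ₜ 1) * Ψ (1 ⊗ₜ g) := by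
    rw [← map_mul, Algebra.TensorProduct.tmul_mul_tmul, mul_one, one_mul]
  rw [h1, ← swapFactors_tmul Ψ 1 g]
  exact (h.isHomogeneous_left hf).mul (h.swap.isHomogeneous_left hg)

theorem derivation_const_of_mem_span (D : Derivation K (MvPolynomial ι K) (MvPolynomial ι K))
    {s : Set (MvPolynomial ι K)} (hD : ∀ p ∈ s, ∃ c, D p = C c) {p : MvPolynomial ι K}
    (hp : p ∈ Submodule.span K s) : ∃ c, D p = C c := by
  induction hp using Submodule.span_induction with
  | mem x hx => exact hD x hx
  | zero => exact ⟨0, by simp⟩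
  | add x y _ _ hx hy =>
    obtain ⟨a, ha⟩ := hx
    obtain ⟨b, hb⟩ := hy
    exact ⟨a + b, by simp [ha, hb]⟩
  | smul c x _ hx =>
    obtain ⟨a, ha⟩ := hx
    exact ⟨c * a, by simp [ha, smul_eq_C_mul]⟩

theorem pderiv_X_const (i j : ι) :
    ∃ c, pderiv i (X j : MvPolynomial ι K) = C c := by
  classical
  refine ⟨if i = j then 1 else 0, ?_⟩
  rw [pderiv_X, Pi.single_apply]
  split_ifs with h h' h' <;> simp_all

/-- The coordinates of the product need not be adapted to the factors, but each is a linear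
combination of the variables of both, on which the derivation is constant. -/
theorem IsLinearTensorEquiv.boxDerivation_X (h : IsLinearTensorEquiv Ψ) (i : ι₁) (k : ι) :
    ∃ c, boxDerivation Ψ (pderiv i) (X k) = C c := by
  have hk : (X k : MvPolynomial ι K) ∈ Submodule.span K
      (Set.range (fun i : ι₁ => Ψ (X i ⊗ₜ 1)) ∪ Set.range fun j : ι₂ => Ψ (1 ⊗ₜ X j)) := by
    rw [Submodule.span_union, ← h]
    exact Submodule.subset_span ⟨k, rfl⟩
  refine derivation_const_of_mem_span _ ?_ hk
  rintro _ (⟨j, rfl⟩ | ⟨j, rfl⟩)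
  · obtain ⟨c, hc⟩ := pderiv_X_const (K := K) i j
    refine ⟨c, ?_⟩
    dsimp only
    rw [boxDerivation_apply_tmul, hc, ← algebraMap_eq, ← Algebra.TensorProduct.algebraMap_apply,
      AlgEquiv.commutes, algebraMap_eq]
  · refine ⟨0, ?_⟩
    dsimp only
    rw [boxDerivation_apply_tmul, pderiv_one, TensorProduct.zero_tmul, map_zero, C_0]

variable (Ψ) in
/-- The span of the operators `u ⊗ w` with `u`, `w` in prescribed families of total order `m`. -/
noncomputable def boxSpan (U : ℕ → Submodule (MvPolynomial ι₁ K) (End K (MvPolynomial ι₁ K)))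
    (W : ℕ → Submodule (MvPolynomial ι₂ K) (End K (MvPolynomial ι₂ K))) (m : ℕ) :
    Submodule K (End K (MvPolynomial ι K)) :=
  Submodule.span K {θ | ∃ p : Finset.HasAntidiagonal.antidiagonal m,
    ∃ u ∈ (U p.1.1).restrictScalars K,
    ∃ w ∈ (W p.1.2).restrictScalars K, θ = box Ψ u w}

theorem box_mem_boxSpan {U : ℕ → Submodule (MvPolynomial ι₁ K) (End K (MvPolynomial ι₁ K))}
    {W : ℕ → Submodule (MvPolynomial ι₂ K) (End K (MvPolynomial ι₂ K))} {m i j : ℕ}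
    (hij : i + j = m) {u : End K (MvPolynomial ι₁ K)} (hu : u ∈ U i)
    {w : End K (MvPolynomial ι₂ K)} (hw : w ∈ W j) : box Ψ u w ∈ boxSpan Ψ U W m :=
  Submodule.subset_span ⟨⟨(i, j), Finset.HasAntidiagonal.mem_antidiagonal.2 hij⟩, u, hu, w, hw, rfl⟩

/-- `boxSpan` is a span over `K`, so that `K`-bases can be used, yet it is stable under `S`, since
`Ψ (f ⊗ g)` acts on `box Ψ u w` through `f • u` and `g • w`. -/
theorem smul_mem_boxSpan {U : ℕ → Submodule (MvPolynomial ι₁ K) (End K (MvPolynomial ι₁ K))}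
    {W : ℕ → Submodule (MvPolynomial ι₂ K) (End K (MvPolynomial ι₂ K))} {m : ℕ}
    (f : MvPolynomial ι K) {θ : End K (MvPolynomial ι K)} (hθ : θ ∈ boxSpan Ψ U W m) :
    f • θ ∈ boxSpan Ψ U W m := by
  induction f using tensorEquiv_induction Ψ with
  | htmul p q =>
    induction hθ using Submodule.span_induction with
    | mem x hx =>
      obtain ⟨i, u, hu, w, hw, rfl⟩ := hx
      rw [smul_box]
      exact box_mem_boxSpan (Finset.HasAntidiagonal.mem_antidiagonal.1 i.2)
        (Submodule.smul_mem _ _ hu)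
        (Submodule.smul_mem _ _ hw)
    | zero => rw [smul_zero]; exact Submodule.zero_mem _
    | add x y _ _ hx hy => rw [smul_add]; exact add_mem hx hy
    | smul c x _ hx =>
      rw [smul_comm]
      exact Submodule.smul_mem _ _ hx
  | hadd a b ha hb => rw [add_smul]; exact add_mem ha hb

/-- Every `∂_k` is a combination of the derivations along the two factors. -/
theorem IsLinearTensorEquiv.exists_pderiv_eq [Fintype ι₁] [Fintype ι₂]
    (h : IsLinearTensorEquiv Ψ) (k : ι) :
    ∃ (c : ι₁ → K) (c' : ι₂ → K), ((pderiv k).toLinearMap : End K (MvPolynomial ι K)) =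
      ∑ i, c i • box Ψ (pderiv i).toLinearMap 1 + ∑ j, c' j • box Ψ 1 (pderiv j).toLinearMap := by
  classical
  have hconst : ∀ p ∈ Submodule.span K (Set.range (X : ι → MvPolynomial ι K)),
      ∃ c, pderiv k p = C c := fun p hp => derivation_const_of_mem_span _ (by
        rintro _ ⟨l, rfl⟩; exact pderiv_X_const k l) hp
  choose c hc using fun i => hconst _ (h.left_mem i)
  choose c' hc' using fun j => hconst _ (h.right_mem j)
  refine ⟨c, c', ?_⟩
  let D : Derivation K (MvPolynomial ι K) (MvPolynomial ι K) :=
    ∑ i, c i • boxDerivation Ψ (pderiv i) + ∑ j, c' j • boxDerivation (swapFactors Ψ) (pderiv j)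
  have hD : D.toLinearMap = ∑ i, c i • box Ψ (pderiv i).toLinearMap 1 +
      ∑ j, c' j • box Ψ 1 (pderiv j).toLinearMap := by
    refine LinearMap.ext fun p => ?_
    simp only [LinearMap.add_apply, LinearMap.sum_apply, ← box_swapFactors Ψ 1]
    change D p = _
    simp only [D, Derivation.add_apply]
    simp only [← Derivation.coeFnAddMonoidHom_apply, map_sum, Finset.sum_apply]
    rfl
  rw [← hD]
  -- Both derivations agree on the variables of the factors, hence on all linear forms, in
  -- particular on the `X l`, which determine a derivation.
  have hle : Submodule.span K (Set.range (X : ι → MvPolynomial ι K)) ≤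
      LinearMap.eqLocus (pderiv k : Derivation K (MvPolynomial ι K) _).toLinearMap
        D.toLinearMap := by
    rw [h, ← Submodule.span_union, Submodule.span_le]
    rintro _ (⟨l, rfl⟩ | ⟨l, rfl⟩)
    · change pderiv k (Ψ (X l ⊗ₜ 1)) = D.toLinearMap _
      rw [hD, hc]
      simp [pderiv_X, Pi.single_apply, LinearMap.sum_apply, TensorProduct.ite_tmul, apply_ite,
        ← Algebra.TensorProduct.one_def, smul_eq_C_mul]
    · change pderiv k (Ψ (1 ⊗ₜ X l)) = D.toLinearMap _
      rw [hD, hc']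
      simp [pderiv_X, Pi.single_apply, LinearMap.sum_apply, apply_ite,
        ← Algebra.TensorProduct.one_def, smul_eq_C_mul]
  have : pderiv k = D := derivation_ext fun l => hle (Submodule.subset_span ⟨l, rfl⟩)
  rw [this]

variable [Fintype ι₁] [Fintype ι]

theorem IsLinearTensorEquiv.box_partialPow_mul_mem (h : IsLinearTensorEquiv Ψ) (m : ℕ) :
    ∀ (a : ι₁ → ℕ), ∑ i, a i = m → ∀ {n : ℕ} {θ : End K (MvPolynomial ι K)},
      θ ∈ constOps K ι n → box Ψ (partialPow K a) 1 * θ ∈ constOps K ι (m + n) := by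
  classical
  induction m with
  | zero =>
    intro a ha n θ hθ
    have ha0 : a = 0 := by
      funext i
      exact (Finset.sum_eq_zero_iff.1 ha) i (Finset.mem_univ i)
    rwa [ha0, partialPow_zero, box_one_one, one_mul, zero_add]
  | succ m ih =>
    intro a ha n θ hθ
    obtain ⟨i, b, rfl, hb⟩ := exists_eq_single_add ha
    rw [partialPow_add, partialPow_single, ← one_mul (1 : End K (MvPolynomial ι₂ K)),
      ← box_mul_box, mul_assoc, ← boxDerivation_toLinearMap, add_right_comm]
    exact derivation_mul_mem_constOps _ (h.boxDerivation_X i) (ih b hb hθ)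

variable [Fintype ι₂]

theorem IsLinearTensorEquiv.box_partialPow_mem (h : IsLinearTensorEquiv Ψ) {m n : ℕ}
    {a : ι₁ → ℕ} (ha : ∑ i, a i = m) {b : ι₂ → ℕ} (hb : ∑ i, b i = n) :
    box Ψ (partialPow K a) (partialPow K b) ∈ constOps K ι (m + n) := by
  have h1 := h.swap.box_partialPow_mul_mem n b hb one_mem_constOps
  rw [mul_one, box_swapFactors, add_zero] at h1
  have h2 := h.box_partialPow_mul_mem m a ha h1
  rwa [box_mul_box, one_mul, mul_one] at h2

theorem IsLinearTensorEquiv.box_mem_diffOps (h : IsLinearTensorEquiv Ψ) {m n : ℕ}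
    {u : End K (MvPolynomial ι₁ K)} (hu : u ∈ diffOps K ι₁ m)
    {w : End K (MvPolynomial ι₂ K)} (hw : w ∈ diffOps K ι₂ n) :
    box Ψ u w ∈ diffOps K ι (m + n) := by
  induction hu using Submodule.span_induction with
  | mem u hu =>
    obtain ⟨a, ha, rfl⟩ := hu
    induction hw using Submodule.span_induction with
    | mem w hw =>
      obtain ⟨b, hb, rfl⟩ := hw
      exact constOps_le_diffOps _ (h.box_partialPow_mem ha hb)
    | zero => rw [map_zero]; exact Submodule.zero_mem _
    | add x y _ _ hx hy => rw [map_add]; exact add_mem hx hy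
    | smul c x _ hx =>
      rw [← one_smul (MvPolynomial ι₁ K) (partialPow K a), ← smul_box]
      exact Submodule.smul_mem _ _ hx
  | zero => rw [map_zero, LinearMap.zero_apply]; exact Submodule.zero_mem _
  | add x y _ _ hx hy => rw [map_add, LinearMap.add_apply]; exact add_mem hx hy
  | smul c x _ hx =>
    rw [← one_smul (MvPolynomial ι₂ K) w, ← smul_box]
    exact Submodule.smul_mem _ _ hx

theorem IsLinearTensorEquiv.box_isHomogeneousOp [DecidableEq ι₁] [DecidableEq ι₂]
    [DecidableEq ι] (h : IsLinearTensorEquiv Ψ) {m n d e : ℕ}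
    {u : End K (MvPolynomial ι₁ K)} (hu : IsHomogeneousOp K m d u)
    {w : End K (MvPolynomial ι₂ K)} (hw : IsHomogeneousOp K n e w) :
    IsHomogeneousOp K (m + n) (d + e) (box Ψ u w) := by
  obtain ⟨f, hf, rfl⟩ := hu
  obtain ⟨g, hg, rfl⟩ := hw
  simp only [map_sum, LinearMap.sum_apply, ← smul_box]
  exact IsHomogeneousOp.sum _ _ fun a ha => IsHomogeneousOp.sum _ _ fun b hb =>
    isHomogeneousOp_smul_const (h.isHomogeneous_tmul (hf _) (hg _))
      (h.box_partialPow_mem (Finset.mem_piAntidiag.1 (by assumption)).1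
        (Finset.mem_piAntidiag.1 (by assumption)).1)

/-- Each `∂_k` is a sum of derivations along the two factors; expanding a product of such sums sorts
`∂^a` by the order in each factor. -/
theorem IsLinearTensorEquiv.diffOps_le_boxSpan (h : IsLinearTensorEquiv Ψ) {m : ℕ}
    {θ : End K (MvPolynomial ι K)} (hθ : θ ∈ diffOps K ι m) :
    θ ∈ boxSpan Ψ (diffOps K ι₁) (diffOps K ι₂) m := by
  classical
  -- the constant coefficient operators suffice
  suffices hc : ∀ m, ∀ a : ι → ℕ, ∑ i, a i = m → partialPow K a ∈
      Submodule.span K {θ | ∃ i j, i + j = m ∧ ∃ u ∈ constOps K ι₁ i, ∃ w ∈ constOps K ι₂ j,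
        θ = box Ψ u w} by
    induction hθ using Submodule.span_induction with
    | mem x hx =>
      obtain ⟨a, ha, rfl⟩ := hx
      refine (Submodule.span_le.2 ?_) (hc m a ha)
      rintro _ ⟨i, j, hij, u, hu, w, hw, rfl⟩
      exact box_mem_boxSpan hij (constOps_le_diffOps _ hu) (constOps_le_diffOps _ hw)
    | zero => exact Submodule.zero_mem _
    | add x y _ _ hx hy => exact add_mem hx hy
    | smul c x _ hx => exact smul_mem_boxSpan c hx
  intro m
  induction m with
  | zero =>
    intro a ha
    have ha0 : a = 0 := by
      funext i
      exact (Finset.sum_eq_zero_iff.1 ha) i (Finset.mem_univ i)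
    rw [ha0, partialPow_zero]
    exact Submodule.subset_span ⟨0, 0, rfl, 1, one_mem_constOps, 1, one_mem_constOps,
      (box_one_one Ψ).symm⟩
  | succ m ih =>
    intro a ha
    obtain ⟨k, b, rfl, hb⟩ := exists_eq_single_add ha
    rw [partialPow_add, partialPow_single]
    obtain ⟨c, c', hcc⟩ := h.exists_pderiv_eq k
    rw [hcc]
    have hb' := ih b hb
    generalize partialPow K b = θ' at hb' ⊢
    induction hb' using Submodule.span_induction with
    | mem x hx =>
      obtain ⟨i, j, hij, u, hu, w, hw, rfl⟩ := hx
      simp only [add_mul, Finset.sum_mul, smul_mul_assoc, box_mul_box, one_mul]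
      refine add_mem (sum_mem fun l _ => Submodule.smul_mem _ _ (Submodule.subset_span ?_))
        (sum_mem fun l _ => Submodule.smul_mem _ _ (Submodule.subset_span ?_))
      · exact ⟨i + 1, j, by omega, _, pderiv_mul_mem_constOps l hu, _, hw, rfl⟩
      · exact ⟨i, j + 1, by omega, _, hu, _, pderiv_mul_mem_constOps l hw, rfl⟩
    | zero => rw [mul_zero]; exact Submodule.zero_mem _
    | add x y _ _ hx hy => rw [mul_add]; exact add_mem hx hy
    | smul c x _ hx => rw [mul_smul_comm]; exact Submodule.smul_mem _ _ hx

end ProductOps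

end CentralArrangement

namespace CentralArrangement

/-! ### Ideal-preserving operators on a product -/

section ProductPreserving

variable {K ι₁ ι₂ ι : Type*} [Field K]
  {Ψ : MvPolynomial ι₁ K ⊗[K] MvPolynomial ι₂ K ≃ₐ[K] MvPolynomial ι K}
  {Q₁ : MvPolynomial ι₁ K} {Q₂ : MvPolynomial ι₂ K}

/-- If `∑ u_k ⊗ v_k` preserves the ideal of `Q₁ ⊗ Q₂` and the differential operators `v_k` are
linearly independent over `K`, then every `u_k` preserves the ideal of `Q₁`. -/
theorem dvd_of_sum_box_preserves [Fintype ι₂] {κ : Type*} {v : κ → End K (MvPolynomial ι₂ K)}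
    (hv : LinearIndependent K v) (hvD : ∀ k, v k ∈ ⨆ n, diffOps K ι₂ n) (hQ₂ : Q₂ ≠ 0)
    (u : κ →₀ End K (MvPolynomial ι₁ K))
    (hu : ∀ b, Ψ (Q₁ ⊗ₜ Q₂) ∣ (u.sum fun k a => box Ψ a (v k)) (Ψ (Q₁ ⊗ₜ Q₂) * b))
    (k : κ) (p : MvPolynomial ι₁ K) : Q₁ ∣ u k (Q₁ * p) := by
  by_contra hn
  have hn' : u k (Q₁ * p) ∉ (Ideal.span {Q₁}).restrictScalars K := by
    rw [Submodule.restrictScalars_mem, Ideal.mem_span_singleton]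
    exact hn
  -- A functional that vanishes on `Q₁S₁` but not on the offending value `u k (Q₁ * p)`.
  obtain ⟨l, hl, hle⟩ := Submodule.exists_le_ker_of_notMem hn'
  have hl0 : ∀ f, l (Q₁ * f) = 0 := fun f =>
    hle (show Q₁ * f ∈ Ideal.span {Q₁} from Ideal.mem_span_singleton.2 (dvd_mul_right _ _))
  have hslice : ∀ b, slice (swapFactors Ψ) l (Ψ (Q₁ ⊗ₜ Q₂) * b) = 0 := by
    intro b
    induction b using tensorEquiv_induction Ψ with
    | htmul f g =>
      rw [← map_mul, Algebra.TensorProduct.tmul_mul_tmul, ← swapFactors_tmul, slice_tmul, hl0,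
        zero_smul]
    | hadd a b ha hb => rw [mul_add, map_add, ha, hb, add_zero]
  -- Contracting the first factor with `l` leaves a differential operator on `S₂` that vanishes on
  -- `Q₂S₂`, hence is zero.
  have hT : ∑ k ∈ u.support, l (u k (Q₁ * p)) • v k = 0 := by
    refine eq_zero_of_vanishes hQ₂ (sum_mem fun k _ => Submodule.smul_of_tower_mem _ _ (hvD k))
      fun q => ?_
    obtain ⟨b, hb⟩ := hu (Ψ (p ⊗ₜ q))
    have h0 := hslice b
    rw [← hb, ← map_mul, Algebra.TensorProduct.tmul_mul_tmul, Finsupp.sum, LinearMap.sum_apply,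
      map_sum] at h0
    rw [LinearMap.sum_apply, ← h0]
    refine Finset.sum_congr rfl fun k _ => ?_
    rw [box_apply_tmul, ← swapFactors_tmul, slice_tmul, LinearMap.smul_apply]
  have hk : k ∈ u.support := by
    rw [Finsupp.mem_support_iff]
    intro h0
    rw [h0, LinearMap.zero_apply, map_zero] at hl
    exact hl rfl
  exact hl (linearIndependent_iff'.1 hv _ _ hT k hk)

variable (Ψ) in
/-- The operator on the first factor obtained from an operator on the product by inserting `q`
and contracting with `l`. -/
noncomputable def sliceOp (l : MvPolynomial ι₂ K →ₗ[K] K) (q : MvPolynomial ι₂ K)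
    (θ : End K (MvPolynomial ι K)) : End K (MvPolynomial ι₁ K) :=
  slice Ψ l ∘ₗ θ ∘ₗ Ψ.toLinearMap ∘ₗ (TensorProduct.mk K _ _).flip q

theorem sliceOp_apply (l : MvPolynomial ι₂ K →ₗ[K] K) (q : MvPolynomial ι₂ K)
    (θ : End K (MvPolynomial ι K)) (p : MvPolynomial ι₁ K) :
    sliceOp Ψ l q θ p = slice Ψ l (θ (Ψ (p ⊗ₜ q))) := rfl

theorem sliceOp_zero (l : MvPolynomial ι₂ K →ₗ[K] K) (q : MvPolynomial ι₂ K) :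
    sliceOp Ψ l q 0 = 0 :=
  LinearMap.ext fun p => by
    rw [sliceOp_apply, LinearMap.zero_apply, map_zero, LinearMap.zero_apply]

theorem sliceOp_add (l : MvPolynomial ι₂ K →ₗ[K] K) (q : MvPolynomial ι₂ K)
    (θ η : End K (MvPolynomial ι K)) :
    sliceOp Ψ l q (θ + η) = sliceOp Ψ l q θ + sliceOp Ψ l q η :=
  LinearMap.ext fun p => by
    rw [LinearMap.add_apply, sliceOp_apply, sliceOp_apply, sliceOp_apply, LinearMap.add_apply,
      map_add]

theorem sliceOp_smul (l : MvPolynomial ι₂ K →ₗ[K] K) (q : MvPolynomial ι₂ K)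
    (f : MvPolynomial ι₁ K) (θ : End K (MvPolynomial ι K)) :
    sliceOp Ψ l q (Ψ (f ⊗ₜ 1) • θ) = f • sliceOp Ψ l q θ :=
  LinearMap.ext fun p => by
    rw [LinearMap.smul_apply, sliceOp_apply, sliceOp_apply, LinearMap.smul_apply, smul_eq_mul,
      slice_mul, smul_eq_mul]

theorem sliceOp_box (l : MvPolynomial ι₂ K →ₗ[K] K) (q : MvPolynomial ι₂ K)
    (u : End K (MvPolynomial ι₁ K)) (w : End K (MvPolynomial ι₂ K)) :
    sliceOp Ψ l q (box Ψ u w) = l (w q) • u := by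
  refine LinearMap.ext fun p => ?_
  rw [sliceOp_apply, box_apply_tmul, slice_tmul, LinearMap.smul_apply]

variable [Fintype ι₁] [Fintype ι₂] [Fintype ι]

theorem IsLinearTensorEquiv.box_mem_preservingOps (h : IsLinearTensorEquiv Ψ) {i j m : ℕ}
    (hij : i + j = m) {u : End K (MvPolynomial ι₁ K)} (hu : u ∈ preservingOps Q₁ i)
    {w : End K (MvPolynomial ι₂ K)} (hw : w ∈ preservingOps Q₂ j) :
    box Ψ u w ∈ preservingOps (Ψ (Q₁ ⊗ₜ Q₂)) m := by
  subst hij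
  refine ⟨h.box_mem_diffOps hu.1 hw.1, fun b => ?_⟩
  induction b using tensorEquiv_induction Ψ with
  | htmul p q =>
    rw [← map_mul, Algebra.TensorProduct.tmul_mul_tmul, box_apply_tmul]
    obtain ⟨a, ha⟩ := hu.2 p
    obtain ⟨b, hb⟩ := hw.2 q
    rw [ha, hb, ← Algebra.TensorProduct.tmul_mul_tmul, map_mul]
    exact dvd_mul_right _ _
  | hadd a b ha hb => rw [mul_add, map_add]; exact dvd_add ha hb

theorem iSupIndep_preservingOps_antidiagonal [CharZero K] (Q : MvPolynomial ι K) (m : ℕ)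
    {f : Finset.HasAntidiagonal.antidiagonal m → ℕ} (hf : Function.Injective f) :
    iSupIndep fun p => preservingOps Q (f p) :=
  (iSupIndep_diffOps.comp hf).mono fun p => preservingOps_le_diffOps Q (f p)

theorem linearIndependent_sigma_preservingOps [CharZero K] {Q : MvPolynomial ι K} {m : ℕ}
    {f : Finset.HasAntidiagonal.antidiagonal m → ℕ} (hf : Function.Injective f)
    {κ : Finset.HasAntidiagonal.antidiagonal m → Type*}
    (θ : ∀ p, Basis (κ p) (MvPolynomial ι K) (preservingOps Q (f p))) :
    LinearIndependent (MvPolynomial ι K)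
      (fun k : Σ p, κ p => (θ k.1 k.2 : End K (MvPolynomial ι K))) :=
  linearIndependent_sigma_of_iSupIndep (iSupIndep_preservingOps_antidiagonal Q m hf)
    (fun p => ⇑(θ p)) (fun p => (θ p).linearIndependent)

theorem injective_antidiagonal_fst (m : ℕ) :
    Function.Injective fun p : Finset.HasAntidiagonal.antidiagonal m => p.1.1 := by
  rintro ⟨⟨a, b⟩, h⟩ ⟨⟨c, d⟩, h'⟩ (rfl : a = c)
  rw [Finset.HasAntidiagonal.mem_antidiagonal] at h h'
  simp only [Subtype.mk.injEq, Prod.mk.injEq, true_and]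
  dsimp only at h h'
  omega

theorem injective_antidiagonal_snd (m : ℕ) :
    Function.Injective fun p : Finset.HasAntidiagonal.antidiagonal m => p.1.2 := by
  rintro ⟨⟨a, b⟩, h⟩ ⟨⟨c, d⟩, h'⟩ (rfl : b = d)
  rw [Finset.HasAntidiagonal.mem_antidiagonal] at h h'
  simp only [Subtype.mk.injEq, Prod.mk.injEq, and_true]
  dsimp only at h h'
  omega

theorem restrictScalars_iSupIndep {R N I : Type*} [CommRing R] [Algebra K R] [AddCommGroup N]
    [Module R N] [Module K N] [IsScalarTower K R N] {p : I → Submodule R N} (hp : iSupIndep p) :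
    iSupIndep fun i => (p i).restrictScalars K := by
  classical
  refine iSupIndep_of_dfinsupp_lsum_injective _ ?_
  exact hp.dfinsupp_lsum_injective

/-- The operators preserving `Q₁ ⊗ Q₂` are spanned by the products of operators preserving `Q₁`
and operators preserving `Q₂`. -/
theorem IsLinearTensorEquiv.preservingOps_le_boxSpan [CharZero K] (h : IsLinearTensorEquiv Ψ)
    (hQ₁ : Q₁ ≠ 0) (hQ₂ : Q₂ ≠ 0) {m : ℕ} {θ : End K (MvPolynomial ι K)}
    (hθ : θ ∈ preservingOps (Ψ (Q₁ ⊗ₜ Q₂)) m) :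
    θ ∈ boxSpan Ψ (preservingOps Q₁) (preservingOps Q₂) m := by
  -- First pass: with a `K`-basis of each `D^(j)(S₂)` on the right, the left coefficients preserve
  -- `Q₁`.
  have hleft : θ ∈ boxSpan Ψ (preservingOps Q₁) (diffOps K ι₂) m := by
    obtain ⟨f, hf, hsum⟩ := exists_finsupp_of_mem_span_bilinear (box Ψ) _ _
      (fun p : Finset.HasAntidiagonal.antidiagonal m => Basis.ofVectorSpace K
        ((diffOps K ι₂ p.1.2).restrictScalars K)) (h.diffOps_le_boxSpan hθ.1)
    have hli := linearIndependent_sigma_of_iSupIndep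
      (restrictScalars_iSupIndep (K := K)
        ((iSupIndep_diffOps (K := K) (ι := ι₂)).comp (injective_antidiagonal_snd m)))
      (fun p => Basis.ofVectorSpace K ((diffOps K ι₂ p.1.2).restrictScalars K))
      (fun p => Basis.linearIndependent _)
    rw [← hsum]
    refine sum_mem fun k _ => box_mem_boxSpan (i := k.1.1.1) (j := k.1.1.2)
      (Finset.HasAntidiagonal.mem_antidiagonal.1 k.1.2)
      (mem_preservingOps.2 ⟨hf k, dvd_of_sum_box_preserves (Ψ := Ψ) hli (fun k => ?_) hQ₂ f ?_ k⟩)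
      (Subtype.mem _)
    · exact Submodule.mem_iSup_of_mem k.1.1.2 (Subtype.mem _)
    · rw [hsum]; exact hθ.2
  -- Second pass, with the factors exchanged: now the expansion uses a `K`-basis of the operators
  -- preserving `Q₁`, so the gain of the first pass is kept.
  have hleft' : θ ∈ Submodule.span K {θ | ∃ p : Finset.HasAntidiagonal.antidiagonal m,
      ∃ w ∈ (diffOps K ι₂ p.1.2).restrictScalars K,
        ∃ u ∈ (preservingOps Q₁ p.1.1).restrictScalars K, θ = box (swapFactors Ψ) w u} := by
    refine Submodule.span_mono ?_ hleft
    rintro _ ⟨p, u, hu, w, hw, rfl⟩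
    exact ⟨p, w, hw, u, hu, (box_swapFactors Ψ u w).symm⟩
  obtain ⟨f, hf, hsum⟩ := exists_finsupp_of_mem_span_bilinear (box (swapFactors Ψ)) _ _
    (fun p : Finset.HasAntidiagonal.antidiagonal m => Basis.ofVectorSpace K
      ((preservingOps Q₁ p.1.1).restrictScalars K)) hleft'
  have hli := linearIndependent_sigma_of_iSupIndep
    (restrictScalars_iSupIndep (K := K)
      (iSupIndep_preservingOps_antidiagonal Q₁ m (injective_antidiagonal_fst m)))
    (fun p => Basis.ofVectorSpace K ((preservingOps Q₁ p.1.1).restrictScalars K))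
    (fun p => Basis.linearIndependent _)
  rw [← hsum]
  refine sum_mem fun k _ => ?_
  dsimp only
  rw [box_swapFactors]
  refine box_mem_boxSpan (i := k.1.1.1) (j := k.1.1.2)
    (Finset.HasAntidiagonal.mem_antidiagonal.1 k.1.2) (Subtype.mem _)
    (mem_preservingOps.2 ⟨hf k, dvd_of_sum_box_preserves (Ψ := swapFactors Ψ) hli
      (fun k => ?_) hQ₁ f ?_ k⟩)
  · exact Submodule.mem_iSup_of_mem k.1.1.1 (preservingOps_le_diffOps _ _ (Subtype.mem _))
  · rw [hsum, swapFactors_tmul]; exact hθ.2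

section Basis

variable {m : ℕ} {κ κ' : Finset.HasAntidiagonal.antidiagonal m → Type*}
  (θ : ∀ p, Basis (κ p) (MvPolynomial ι₁ K) (preservingOps Q₁ p.1.1))
  (η : ∀ p, Basis (κ' p) (MvPolynomial ι₂ K) (preservingOps Q₂ p.1.2))

/-- Different pairs `p` have different orders in the first factor, so the `θ` are jointly
independent over all `p`; for each `p` the independence of `η p` suffices. -/
theorem IsLinearTensorEquiv.exists_box_basis [CharZero K] [∀ p, Fintype (κ p)]
    [∀ p, Fintype (κ' p)] (h : IsLinearTensorEquiv Ψ) (hQ₁ : Q₁ ≠ 0) (hQ₂ : Q₂ ≠ 0) :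
    ∃ b : Basis (Σ k : Σ p, κ p, κ' k.1) (MvPolynomial ι K) (preservingOps (Ψ (Q₁ ⊗ₜ Q₂)) m),
      ∀ k, (b k : End K (MvPolynomial ι K)) = box Ψ (θ k.1.1 k.1.2 : End K (MvPolynomial ι₁ K))
        (η k.1.1 k.2 : End K (MvPolynomial ι₂ K)) := by
  let v : (Σ k : Σ p, κ p, κ' k.1) → preservingOps (Ψ (Q₁ ⊗ₜ Q₂)) m := fun k =>
    ⟨box Ψ (θ k.1.1 k.1.2 : End K (MvPolynomial ι₁ K)) (η k.1.1 k.2 : End K (MvPolynomial ι₂ K)),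
      h.box_mem_preservingOps (Finset.HasAntidiagonal.mem_antidiagonal.1 k.1.1.2)
        (Subtype.mem _) (Subtype.mem _)⟩
  have hli : LinearIndependent (MvPolynomial ι K) v := by
    have hθ := linearIndependent_sigma_preservingOps (injective_antidiagonal_fst m) θ
    have hη : ∀ k : Σ p, κ p, LinearIndependent (MvPolynomial ι₂ K)
        (fun l => (η k.1 l : End K (MvPolynomial ι₂ K))) := fun k =>
      linearIndependent_coe_basis (η k.1)
    have hbox := linearIndependent_box Ψ hθ hη
    exact LinearIndependent.of_comp (Submodule.subtype (preservingOps (Ψ (Q₁ ⊗ₜ Q₂)) m)) hbox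
  have hspan : ∀ x ∈ boxSpan Ψ (preservingOps Q₁) (preservingOps Q₂) m,
      x ∈ (Submodule.span (MvPolynomial ι K) (Set.range v)).map (Submodule.subtype _) := by
    intro x hx
    induction hx using Submodule.span_induction with
    | mem x hx =>
      obtain ⟨p, u, hu, w, hw, rfl⟩ := hx
      obtain ⟨f, rfl⟩ := exists_eq_sum_smul_basis (θ p) hu
      obtain ⟨g, rfl⟩ := exists_eq_sum_smul_basis (η p) hw
      simp only [map_sum, LinearMap.sum_apply, ← smul_box]
      refine sum_mem fun j _ => sum_mem fun l _ => ?_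
      exact Submodule.smul_mem _ _ ⟨v ⟨⟨p, _⟩, _⟩, Submodule.subset_span ⟨_, rfl⟩, rfl⟩
    | zero => exact Submodule.zero_mem _
    | add x y _ _ hx hy => exact add_mem hx hy
    | smul c x _ hx => exact Submodule.smul_of_tower_mem _ c hx
  refine ⟨Basis.mk hli ?_, fun k => by rw [Basis.mk_apply]⟩
  intro x _
  obtain ⟨y, hy, hyx⟩ := hspan x.1 (h.preservingOps_le_boxSpan hQ₁ hQ₂ x.2)
  rwa [← Subtype.ext (a1 := y) (a2 := x) hyx]

end Basis

/-! ### Each factor module as a direct summand of the product module -/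

section Retract

theorem apply_monomialOf_eq_zero {m n : ℕ} (hmn : m < n) {w : End K (MvPolynomial ι K)}
    (hw : w ∈ diffOps K ι n) {a : ι → ℕ} (ha : ∑ i, a i = m) : w (monomialOf a) = 0 := by
  classical
  induction hw using Submodule.span_induction with
  | mem x hx =>
    obtain ⟨b, hb, rfl⟩ := hx
    exact (partialPow_isHomogeneous n b hb (monomialOf_degree ha)).2 hmn
  | zero => rfl
  | add x y _ _ hx hy => rw [LinearMap.add_apply, hx, hy, add_zero]
  | smul c x _ hx => rw [LinearMap.smul_apply, hx, smul_zero]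

theorem exists_monomialOf_apply_ne_zero [CharZero K] {n : ℕ} {w : End K (MvPolynomial ι K)}
    (hw : w ∈ diffOps K ι n) (hne : w ≠ 0) :
    ∃ a : ι → ℕ, ∑ i, a i = n ∧ w (monomialOf a) ≠ 0 := by
  classical
  by_contra! h0
  apply hne
  rw [← symbolProj_eq_self hw, symbolProj_apply]
  refine Finset.sum_eq_zero fun a ha => ?_
  rw [h0 a (Finset.mem_piAntidiag.1 ha).1, mul_zero, zero_smul]

/-- The map `u ↦ u ⊗ w₀`, with `w₀ ≠ 0` of order `m - i`, has an `S₁`-linear left inverse: insert a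
monomial on which `w₀` is nonzero, contract with `l`, and project to order `i`. -/
theorem IsLinearTensorEquiv.projective_left [CharZero K] [Nonempty ι₂]
    (h : IsLinearTensorEquiv Ψ) (hQ₁ : Q₁ ≠ 0) (hQ₂ : Q₂ ≠ 0) {m i : ℕ} (hi : i ≤ m)
    (hfree : Module.Free (MvPolynomial ι K) (preservingOps (Ψ (Q₁ ⊗ₜ Q₂)) m)) :
    Module.Projective (MvPolynomial ι₁ K) (preservingOps Q₁ i) := by
  classical
  obtain ⟨w₀, hw₀, hne⟩ := exists_ne_zero_mem_preservingOps hQ₂ (m - i)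
  obtain ⟨a, ha, hane⟩ := exists_monomialOf_apply_ne_zero hw₀.1 hne
  obtain ⟨l₀, hl₀⟩ : ∃ l₀ : Dual K (MvPolynomial ι₂ K), l₀ (w₀ (monomialOf a)) ≠ 0 := by
    by_contra! h0
    exact hane ((Module.forall_dual_apply_eq_zero_iff K _).1 h0)
  let l : MvPolynomial ι₂ K →ₗ[K] K := (l₀ (w₀ (monomialOf a)))⁻¹ • l₀
  have hl : l (w₀ (monomialOf a)) = 1 := inv_mul_cancel₀ hl₀
  -- `S` is an `S₁`-algebra through `Ψ`, free because `S₁ ⊗ S₂` is; so freeness over `S` descends to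
  -- freeness over `S₁`.
  let _ : Algebra (MvPolynomial ι₁ K) (MvPolynomial ι K) :=
    (Ψ.toRingHom.comp (Algebra.TensorProduct.includeLeftRingHom)).toAlgebra
  have hsmul : ∀ (f : MvPolynomial ι₁ K) (g : MvPolynomial ι K), f • g = Ψ (f ⊗ₜ 1) * g :=
    fun _ _ => rfl
  let _ : Module (MvPolynomial ι₁ K) (preservingOps (Ψ (Q₁ ⊗ₜ Q₂)) m) :=
    Module.compHom _ (algebraMap (MvPolynomial ι₁ K) (MvPolynomial ι K))
  have hsmul' : ∀ (f : MvPolynomial ι₁ K) (x : preservingOps (Ψ (Q₁ ⊗ₜ Q₂)) m),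
    f • x = Ψ (f ⊗ₜ 1) • x := fun _ _ => rfl
  have : IsScalarTower (MvPolynomial ι₁ K) (MvPolynomial ι K)
      (preservingOps (Ψ (Q₁ ⊗ₜ Q₂)) m) := ⟨fun f g x => by
        rw [hsmul, hsmul', mul_smul]⟩
  have : Module.Free (MvPolynomial ι₁ K) (MvPolynomial ι K) := by
    let e : MvPolynomial ι₁ K ⊗[K] MvPolynomial ι₂ K ≃ₗ[MvPolynomial ι₁ K] MvPolynomial ι K :=
      { Ψ.toAddEquiv with
        map_smul' := fun f t => by
          change Ψ (f • t) = f • Ψ t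
          rw [hsmul, ← map_mul]
          congr 1
          exact Algebra.smul_def f t }
    exact Module.Free.of_equiv e
  have : Module.Free (MvPolynomial ι₁ K) (preservingOps (Ψ (Q₁ ⊗ₜ Q₂)) m) :=
    Module.Free.trans (S := MvPolynomial ι K)
  let incl : preservingOps Q₁ i →ₗ[MvPolynomial ι₁ K] preservingOps (Ψ (Q₁ ⊗ₜ Q₂)) m :=
    { toFun := fun u => ⟨box Ψ u.1 w₀, h.box_mem_preservingOps (by omega) u.2 hw₀⟩
      map_add' := fun u u' => Subtype.ext (LinearMap.map_add₂ (box Ψ) u.1 u'.1 w₀)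
      map_smul' := fun f u => Subtype.ext (by
        have := smul_box Ψ f 1 u.1 w₀
        rw [one_smul] at this
        exact this.symm) }
  have hmem : ∀ x ∈ boxSpan Ψ (preservingOps Q₁) (preservingOps Q₂) m,
      symbolProj K ι₁ i (sliceOp Ψ l (monomialOf a) x) ∈ preservingOps Q₁ i := by
    intro x hx
    induction hx using Submodule.span_induction with
    | mem x hx =>
      obtain ⟨p, u, hu, w, hw, rfl⟩ := hx
      have hp := Finset.HasAntidiagonal.mem_antidiagonal.1 p.2
      rw [sliceOp_box]
      -- If `u` has order below `i`, then `w` has order above `m - i` and kills the monomial; if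
      -- above `i`, `symbolProj` kills `u`; only order `i` survives.
      rcases lt_trichotomy p.1.1 i with hlt | heq | hgt
      · rw [apply_monomialOf_eq_zero (n := p.1.2) (by omega) hw.1 ha, map_zero, zero_smul, map_zero]
        exact Submodule.zero_mem _
      · have hmem : l (w (monomialOf a)) • u ∈ preservingOps Q₁ i := by
          rw [← heq]; exact Submodule.smul_of_tower_mem _ _ hu
        rw [symbolProj_eq_self hmem.1]
        exact hmem
      · have hmem : l (w (monomialOf a)) • u ∈ preservingOps Q₁ p.1.1 :=
          Submodule.smul_of_tower_mem _ _ hu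
        rw [symbolProj_eq_zero hgt hmem.1]
        exact Submodule.zero_mem _
    | zero =>
      rw [sliceOp_zero, map_zero]
      exact Submodule.zero_mem _
    | add x y _ _ hx hy =>
      rw [sliceOp_add, map_add]
      exact add_mem hx hy
    | smul c x _ hx =>
      have hc : c • x = Ψ (C c ⊗ₜ 1) • x := by
        rw [← algebraMap_eq, ← Algebra.TensorProduct.algebraMap_apply, AlgEquiv.commutes]
        exact (algebraMap_smul _ c x).symm
      rw [hc, sliceOp_smul, map_smul]
      exact Submodule.smul_mem _ _ hx
  let retr : preservingOps (Ψ (Q₁ ⊗ₜ Q₂)) m →ₗ[MvPolynomial ι₁ K] preservingOps Q₁ i :=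
    { toFun := fun x => ⟨symbolProj K ι₁ i (sliceOp Ψ l (monomialOf a) x.1),
        hmem _ (h.preservingOps_le_boxSpan hQ₁ hQ₂ x.2)⟩
      map_add' := fun x y => Subtype.ext
        ((congrArg _ (sliceOp_add l _ x.1 y.1)).trans (map_add _ _ _))
      map_smul' := fun f x => Subtype.ext
        ((congrArg _ (sliceOp_smul l _ f x.1)).trans (map_smul _ _ _)) }
  refine Module.Projective.of_split incl retr (LinearMap.ext fun u => Subtype.ext ?_)
  change symbolProj K ι₁ i (sliceOp Ψ l (monomialOf a) (box Ψ u.1 w₀)) = u.1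
  rw [sliceOp_box, hl, one_smul, symbolProj_eq_self u.2.1]

end Retract

end ProductPreserving

end CentralArrangement

namespace CentralArrangement

section Cyclic

variable {R N : Type*} [Ring R] [AddCommGroup N] [Module R N]

theorem exists_basis_of_generator (p : Submodule R N) {x : N} (hx : x ∈ p)
    (hgen : ∀ y ∈ p, ∃ f : R, y = f • x) (hx0 : ∀ f : R, f • x = 0 → f = 0) :
    ∃ b : Basis (Fin 1) R p, ∀ j, (b j : N) = x := by
  let v : Fin 1 → p := fun _ => ⟨x, hx⟩
  have hli : LinearIndependent R v := by
    refine Fintype.linearIndependent_iff.2 fun f hf j => ?_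
    rw [Fin.sum_univ_one] at hf
    rw [Fin.fin_one_eq_zero j]
    exact hx0 _ (congrArg Subtype.val hf)
  refine ⟨Basis.mk hli fun y _ => ?_, fun j => by rw [Basis.mk_apply]⟩
  obtain ⟨f, hf⟩ := hgen y y.2
  have : y = f • v 0 := Subtype.ext hf
  rw [this]
  exact Submodule.smul_mem _ _ (Submodule.subset_span ⟨0, rfl⟩)

theorem coe_basis_map_ofEq {κ : Type*} {p q : Submodule R N} (h : p = q) (b : Basis κ R p) (k : κ) :
    (b.map (LinearEquiv.ofEq p q h) k : N) = b k := rfl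

end Cyclic

/-! ### Defining polynomials and coordinate rings of arrangements -/

section Coordinates

variable {K V ι : Type*} [Field K] [AddCommGroup V] [Module K V] [Fintype ι]
  (x : Basis ι K (Dual K V))

/-- `formPoly` as a linear map. -/
noncomputable def formPolyₗ : Dual K V →ₗ[K] MvPolynomial ι K where
  toFun := formPoly x
  map_add' α β := by simp [formPoly, add_mul, Finset.sum_add_distrib]
  map_smul' c α := by
    simp [formPoly, Finset.smul_sum, smul_eq_C_mul, mul_assoc]

theorem formPolyₗ_apply (α : Dual K V) : formPolyₗ x α = formPoly x α := rfl

theorem formPoly_basis (i : ι) : formPoly x (x i) = X i := by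
  classical
  rw [formPoly, Finset.sum_eq_single i]
  · simp
  · intro j _ hj
    simp [Finsupp.single_eq_of_ne hj]
  · simp

theorem formPoly_mem_span (α : Dual K V) :
    formPoly x α ∈ Submodule.span K (Set.range (X : ι → MvPolynomial ι K)) := by
  refine sum_mem fun i _ => ?_
  rw [← smul_eq_C_mul]
  exact Submodule.smul_mem _ _ (Submodule.subset_span ⟨i, rfl⟩)

theorem formPoly_isHomogeneous (α : Dual K V) : (formPoly x α).IsHomogeneous 1 := by
  rw [← mem_homogeneousSubmodule, homogeneousSubmodule_one_eq_span_X]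
  exact formPoly_mem_span x α

theorem formPoly_ne_zero {α : Dual K V} (hα : α ≠ 0) : formPoly x α ≠ 0 := by
  classical
  intro h
  apply hα
  apply x.repr.injective
  rw [map_zero]
  ext i
  have h1 := congrArg (coeff (Finsupp.single i 1)) h
  rw [formPoly, coeff_sum] at h1
  simpa [coeff_C_mul, coeff_X, Finsupp.single_left_inj] using h1

theorem linearForm_ne_zero {H : Submodule K V} (hH : IsCoatom H) : linearForm H ≠ 0 := by
  intro h
  have := ker_linearForm hH
  rw [h, LinearMap.ker_zero] at this
  exact hH.1 this.symm

theorem definingPoly_ne_zero (A : CentralArrangement K V) : A.definingPoly x ≠ 0 :=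
  Finset.prod_ne_zero_iff.2 fun _ hH => formPoly_ne_zero x (linearForm_ne_zero (A.isCoatom _ hH))

theorem definingPoly_isHomogeneous (A : CentralArrangement K V) :
    (A.definingPoly x).IsHomogeneous (∑ _H ∈ A.hyperplanes, 1) :=
  IsHomogeneous.prod _ _ _ fun _ _ => formPoly_isHomogeneous x _

theorem exists_eq_smul_of_ker_eq {α β : Dual K V} (h : LinearMap.ker α = LinearMap.ker β)
    (hβ : β ≠ 0) : ∃ c : K, c ≠ 0 ∧ β = c • α := by
  have h1 : β ∈ Submodule.span K (Set.range fun _ : Unit => α) :=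
    mem_span_of_iInf_ker_le_ker (by simp [h])
  rw [Set.range_const, Submodule.mem_span_singleton] at h1
  obtain ⟨c, hc⟩ := h1
  refine ⟨c, ?_, hc.symm⟩
  rintro rfl
  rw [zero_smul] at hc
  exact hβ hc.symm

theorem associated_formPoly {α β : Dual K V} (h : LinearMap.ker α = LinearMap.ker β)
    (hβ : β ≠ 0) : Associated (formPoly x α) (formPoly x β) := by
  obtain ⟨c, hc, rfl⟩ := exists_eq_smul_of_ker_eq h hβ
  rw [← formPolyₗ_apply, ← formPolyₗ_apply, map_smul, smul_eq_C_mul]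
  exact ⟨Units.map (C : K →+* MvPolynomial ι K).toMonoidHom (Units.mk0 c hc), mul_comm _ _⟩

theorem diffModule_eq_preservingOps (A : CentralArrangement K V) (m : ℕ) :
    A.diffModule x m = preservingOps (A.definingPoly x) m := by
  ext θ
  refine and_congr_right fun _ => ⟨fun h p => ?_, fun h p hp => ?_⟩
  · exact Ideal.mem_span_singleton.1 (h _ (Ideal.mem_span_singleton.2 (dvd_mul_right _ _)))
  · obtain ⟨q, rfl⟩ := Ideal.mem_span_singleton.1 hp
    exact Ideal.mem_span_singleton.2 (h q)

end Coordinates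

section ProductCoordinates

variable {K V₁ V₂ ι₁ ι₂ ι : Type*} [Field K] [AddCommGroup V₁] [Module K V₁]
  [AddCommGroup V₂] [Module K V₂] [Fintype ι]
  (x : Basis ι₁ K (Dual K V₁)) (y : Basis ι₂ K (Dual K V₂)) (z : Basis ι K (Dual K (V₁ × V₂)))

/-- The comparison of polynomial functions on `V₁` with those on `V`, along a linear map
`V → V₁`. -/
noncomputable def pullback {V : Type*} [AddCommGroup V] [Module K V] (z : Basis ι K (Dual K V))
    (f : V →ₗ[K] V₁) : MvPolynomial ι₁ K →ₐ[K] MvPolynomial ι K :=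
  aeval fun i => formPoly z (x i ∘ₗ f)

theorem pullback_formPoly [Fintype ι₁] {V : Type*} [AddCommGroup V] [Module K V]
    (z : Basis ι K (Dual K V)) (f : V →ₗ[K] V₁) (α : Dual K V₁) :
    pullback x z f (formPoly x α) = formPoly z (α ∘ₗ f) := by
  have h : (pullback x z f).toLinearMap ∘ₗ formPolyₗ x =
      formPolyₗ z ∘ₗ LinearMap.lcomp K K f := by
    refine x.ext fun i => ?_
    change pullback x z f (formPoly x (x i)) = formPoly z (x i ∘ₗ f)
    rw [formPoly_basis, pullback, aeval_X]
  exact LinearMap.congr_fun h α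

/-- The isomorphism `S₁ ⊗ S₂ → S` in the direction of the product. -/
noncomputable def prodHom :
    MvPolynomial ι₁ K ⊗[K] MvPolynomial ι₂ K →ₐ[K] MvPolynomial ι K :=
  Algebra.TensorProduct.productMap (pullback x z (LinearMap.fst K V₁ V₂))
    (pullback y z (LinearMap.snd K V₁ V₂))

theorem prodHom_tmul_one [Fintype ι₁] (α : Dual K V₁) :
    prodHom x y z (formPoly x α ⊗ₜ 1) = formPoly z (α ∘ₗ LinearMap.fst K V₁ V₂) := by
  rw [prodHom, Algebra.TensorProduct.productMap_apply_tmul, map_one, mul_one, pullback_formPoly]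

theorem prodHom_one_tmul [Fintype ι₂] (β : Dual K V₂) :
    prodHom x y z (1 ⊗ₜ formPoly y β) = formPoly z (β ∘ₗ LinearMap.snd K V₁ V₂) := by
  rw [prodHom, Algebra.TensorProduct.productMap_apply_tmul, map_one, one_mul, pullback_formPoly]

variable [Fintype ι₁] [Fintype ι₂]

/-- The inverse of `prodHom`. -/
noncomputable def prodHomInv :
    MvPolynomial ι K →ₐ[K] MvPolynomial ι₁ K ⊗[K] MvPolynomial ι₂ K :=
  aeval fun k => formPoly x (z k ∘ₗ LinearMap.inl K V₁ V₂) ⊗ₜ 1 +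
    1 ⊗ₜ formPoly y (z k ∘ₗ LinearMap.inr K V₁ V₂)

theorem prodHomInv_formPoly (γ : Dual K (V₁ × V₂)) : prodHomInv x y z (formPoly z γ) =
    formPoly x (γ ∘ₗ LinearMap.inl K V₁ V₂) ⊗ₜ 1 +
      1 ⊗ₜ formPoly y (γ ∘ₗ LinearMap.inr K V₁ V₂) := by
  have h : (prodHomInv x y z).toLinearMap ∘ₗ formPolyₗ z =
      (TensorProduct.mk K _ _).flip 1 ∘ₗ formPolyₗ x ∘ₗ
        LinearMap.lcomp K K (LinearMap.inl K V₁ V₂) +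
      TensorProduct.mk K _ _ 1 ∘ₗ formPolyₗ y ∘ₗ LinearMap.lcomp K K (LinearMap.inr K V₁ V₂) := by
    refine z.ext fun k => ?_
    change prodHomInv x y z (formPoly z (z k)) = _
    rw [formPoly_basis, prodHomInv, aeval_X]
    rfl
  exact LinearMap.congr_fun h γ

theorem prodHom_comp_prodHomInv :
    (prodHom x y z).comp (prodHomInv x y z) = AlgHom.id K _ := by
  refine MvPolynomial.algHom_ext fun k => ?_
  rw [AlgHom.comp_apply, ← formPoly_basis z k, prodHomInv_formPoly, map_add, prodHom_tmul_one,
    prodHom_one_tmul, ← formPolyₗ_apply, ← formPolyₗ_apply, ← map_add, AlgHom.id_apply,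
    ← formPolyₗ_apply]
  congr 1
  ext v <;> simp [← Prod.zero_eq_mk]

theorem prodHomInv_comp_prodHom :
    (prodHomInv x y z).comp (prodHom x y z) = AlgHom.id K _ := by
  refine Algebra.TensorProduct.ext ?_ ?_
  · refine MvPolynomial.algHom_ext fun i => ?_
    change prodHomInv x y z (prodHom x y z (X i ⊗ₜ 1)) = X i ⊗ₜ 1
    rw [← formPoly_basis x i, prodHom_tmul_one, prodHomInv_formPoly]
    have h1 : (x i ∘ₗ LinearMap.fst K V₁ V₂) ∘ₗ LinearMap.inl K V₁ V₂ = x i := by ext; simp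
    have h2 : (x i ∘ₗ LinearMap.fst K V₁ V₂) ∘ₗ LinearMap.inr K V₁ V₂ = 0 := by ext; simp
    rw [h1, h2, ← formPolyₗ_apply y, map_zero, TensorProduct.tmul_zero, add_zero]
  · refine MvPolynomial.algHom_ext fun i => ?_
    change prodHomInv x y z (prodHom x y z (1 ⊗ₜ X i)) = 1 ⊗ₜ X i
    rw [← formPoly_basis y i, prodHom_one_tmul, prodHomInv_formPoly]
    have h1 : (y i ∘ₗ LinearMap.snd K V₁ V₂) ∘ₗ LinearMap.inr K V₁ V₂ = y i := by ext; simp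
    have h2 : (y i ∘ₗ LinearMap.snd K V₁ V₂) ∘ₗ LinearMap.inl K V₁ V₂ = 0 := by ext; simp
    rw [h1, h2, ← formPolyₗ_apply x, map_zero, TensorProduct.zero_tmul, zero_add]

/-- The coordinate ring of `V₁ × V₂` is the tensor product of those of `V₁` and `V₂`. -/
noncomputable def prodEquiv :
    MvPolynomial ι₁ K ⊗[K] MvPolynomial ι₂ K ≃ₐ[K] MvPolynomial ι K :=
  AlgEquiv.ofAlgHom (prodHom x y z) (prodHomInv x y z) (prodHom_comp_prodHomInv x y z)
    (prodHomInv_comp_prodHom x y z)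

theorem prodEquiv_apply (t : MvPolynomial ι₁ K ⊗[K] MvPolynomial ι₂ K) :
    prodEquiv x y z t = prodHom x y z t := rfl

theorem isLinearTensorEquiv_prodEquiv : IsLinearTensorEquiv (prodEquiv x y z) := by
  have hX : ∀ i, prodEquiv x y z (X i ⊗ₜ 1) = formPoly z (x i ∘ₗ LinearMap.fst K V₁ V₂) := by
    intro i
    rw [prodEquiv_apply, ← formPoly_basis x i, prodHom_tmul_one]
  have hY : ∀ j, prodEquiv x y z (1 ⊗ₜ X j) = formPoly z (y j ∘ₗ LinearMap.snd K V₁ V₂) := by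
    intro j
    rw [prodEquiv_apply, ← formPoly_basis y j, prodHom_one_tmul]
  apply le_antisymm
  · rw [Submodule.span_le]
    rintro _ ⟨k, rfl⟩
    have hk : (X k : MvPolynomial ι K) =
        prodHom x y z (formPoly x (z k ∘ₗ LinearMap.inl K V₁ V₂) ⊗ₜ 1) +
          prodHom x y z (1 ⊗ₜ formPoly y (z k ∘ₗ LinearMap.inr K V₁ V₂)) := by
      rw [← map_add, ← prodHomInv_formPoly x y z, formPoly_basis]
      exact (AlgHom.congr_fun (prodHom_comp_prodHomInv x y z) (X k)).symm
    rw [hk, prodHom_tmul_one, prodHom_one_tmul]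
    refine Submodule.add_mem_sup ?_ ?_
    · have h : ∀ α : Dual K V₁, formPoly z (α ∘ₗ LinearMap.fst K V₁ V₂) ∈
          Submodule.span K (Set.range fun i => prodEquiv x y z (X i ⊗ₜ 1)) := by
        intro α
        rw [← prodHom_tmul_one x y z, formPoly, TensorProduct.sum_tmul, map_sum]
        refine sum_mem fun i _ => ?_
        rw [← smul_eq_C_mul, ← TensorProduct.smul_tmul', map_smul]
        exact Submodule.smul_mem _ _ (Submodule.subset_span ⟨i, rfl⟩)
      exact h _
    · have h : ∀ β : Dual K V₂, formPoly z (β ∘ₗ LinearMap.snd K V₁ V₂) ∈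
          Submodule.span K (Set.range fun j => prodEquiv x y z (1 ⊗ₜ X j)) := by
        intro β
        rw [← prodHom_one_tmul x y z, formPoly, TensorProduct.tmul_sum, map_sum]
        refine sum_mem fun j _ => ?_
        rw [← smul_eq_C_mul, TensorProduct.tmul_smul, map_smul]
        exact Submodule.smul_mem _ _ (Submodule.subset_span ⟨j, rfl⟩)
      exact h _
  · rw [sup_le_iff, Submodule.span_le, Submodule.span_le]
    constructor
    · rintro _ ⟨i, rfl⟩
      dsimp only
      rw [hX]
      exact formPoly_mem_span z _
    · rintro _ ⟨j, rfl⟩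
      dsimp only
      rw [hY]
      exact formPoly_mem_span z _

/-- The chosen forms for `H ⊕ V₂` and `H` composed with the projection have equal kernels, so they
are proportional. No hyperplane is of both kinds, so each factor occurs exactly once. -/
theorem associated_definingPoly_prod (A₁ : CentralArrangement K V₁)
    (A₂ : CentralArrangement K V₂) :
    Associated (prodEquiv x y z (A₁.definingPoly x ⊗ₜ A₂.definingPoly y))
      ((A₁.prod A₂).definingPoly z) := by
  classical
  have hinj₁ : Function.Injective fun H : Submodule K V₁ => H.prod (⊤ : Submodule K V₂) := by
    intro H H' h
    ext v
    have := congrArg (fun W : Submodule K (V₁ × V₂) => (v, (0 : V₂)) ∈ W) h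
    simpa using this
  have hinj₂ : Function.Injective fun H : Submodule K V₂ => (⊤ : Submodule K V₁).prod H := by
    intro H H' h
    ext v
    have := congrArg (fun W : Submodule K (V₁ × V₂) => ((0 : V₁), v) ∈ W) h
    simpa using this
  have hdisj : Disjoint (A₁.hyperplanes.image fun H => H.prod (⊤ : Submodule K V₂))
      (A₂.hyperplanes.image fun H => (⊤ : Submodule K V₁).prod H) := by
    rw [Finset.disjoint_left]
    intro H h₁ h₂
    obtain ⟨H₁, hH₁, rfl⟩ := Finset.mem_image.1 h₁
    obtain ⟨H₂, _, h⟩ := Finset.mem_image.1 h₂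
    refine (A₁.isCoatom _ hH₁).1 (eq_top_iff.2 fun v _ => ?_)
    have := congrArg (fun W : Submodule K (V₁ × V₂) => (v, (0 : V₂)) ∈ W) h
    simpa using this
  have hQ : (A₁.prod A₂).definingPoly z =
      (∏ H ∈ A₁.hyperplanes, formPoly z (linearForm (H.prod (⊤ : Submodule K V₂)))) *
        ∏ H ∈ A₂.hyperplanes, formPoly z (linearForm ((⊤ : Submodule K V₁).prod H)) := by
    have : (A₁.prod A₂).hyperplanes = A₁.hyperplanes.image (fun H => H.prod (⊤ : Submodule K V₂)) ∪
      A₂.hyperplanes.image (fun H => (⊤ : Submodule K V₁).prod H) := rfl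
    rw [definingPoly, this, Finset.prod_union hdisj, Finset.prod_image hinj₁.injOn,
      Finset.prod_image hinj₂.injOn]
  have hL : prodEquiv x y z (A₁.definingPoly x ⊗ₜ A₂.definingPoly y) =
      (∏ H ∈ A₁.hyperplanes, formPoly z (linearForm H ∘ₗ LinearMap.fst K V₁ V₂)) *
        ∏ H ∈ A₂.hyperplanes, formPoly z (linearForm H ∘ₗ LinearMap.snd K V₁ V₂) := by
    rw [prodEquiv_apply, prodHom, Algebra.TensorProduct.productMap_apply_tmul, definingPoly,
      definingPoly, map_prod, map_prod]
    simp only [pullback_formPoly]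
  rw [hQ, hL]
  refine Associated.mul_mul (Associated.prod _ _ _ fun H hH => ?_)
    (Associated.prod _ _ _ fun H hH => ?_)
  · have hc : IsCoatom (H.prod (⊤ : Submodule K V₂)) :=
      (A₁.prod A₂).isCoatom _ (Finset.mem_union_left _ (Finset.mem_image_of_mem _ hH))
    refine associated_formPoly z ?_ (linearForm_ne_zero hc)
    rw [ker_linearForm hc, LinearMap.ker_comp, ker_linearForm (A₁.isCoatom _ hH)]
    ext v
    simp
  · have hc : IsCoatom ((⊤ : Submodule K V₁).prod H) :=
      (A₁.prod A₂).isCoatom _ (Finset.mem_union_right _ (Finset.mem_image_of_mem _ hH))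
    refine associated_formPoly z ?_ (linearForm_ne_zero hc)
    rw [ker_linearForm hc, LinearMap.ker_comp, ker_linearForm (A₂.isCoatom _ hH)]
    ext v
    simp

theorem diffModule_prod_eq (A₁ : CentralArrangement K V₁) (A₂ : CentralArrangement K V₂) (m : ℕ) :
    (A₁.prod A₂).diffModule z m =
      preservingOps (prodEquiv x y z (A₁.definingPoly x ⊗ₜ A₂.definingPoly y)) m := by
  rw [diffModule_eq_preservingOps]
  exact (preservingOps_congr (associated_definingPoly_prod x y z A₁ A₂) m).symm

end ProductCoordinates

/-! ### Existence and uniqueness of exponents -/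

section Exponents

variable {K V ι : Type*} [Field K] [AddCommGroup V] [Module K V] [Fintype ι]
  (x : Basis ι K (Dual K V)) (A : CentralArrangement K V)

/-- In order zero the module is `S · 1` whatever `Q` is, so the convention `exp_0 = {0}` agrees with
an actual homogeneous basis and order zero can enter the product basis like any other. -/
theorem exists_basis_preservingOps_zero [DecidableEq ι] (Q : MvPolynomial ι K) :
    ∃ b : Basis (Fin 1) (MvPolynomial ι K) (preservingOps Q 0),
      ∀ j, IsHomogeneousOp K 0 0 (b j : End K (MvPolynomial ι K)) := by
  have h1 : (1 : End K (MvPolynomial ι K)) ∈ preservingOps Q 0 :=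
    ⟨constOps_le_diffOps 0 one_mem_constOps, fun p => dvd_mul_right _ _⟩
  have hgen : ∀ θ ∈ preservingOps Q 0, ∃ f : MvPolynomial ι K, θ = f • 1 := by
    intro θ hθ
    have h0 : θ ∈ Submodule.span (MvPolynomial ι K) {(1 : End K (MvPolynomial ι K))} := by
      refine Submodule.span_le.2 ?_ hθ.1
      rintro _ ⟨a, ha, rfl⟩
      have ha0 : a = 0 := by
        funext i
        exact (Finset.sum_eq_zero_iff.1 ha) i (Finset.mem_univ i)
      rw [ha0, partialPow_zero]
      exact Submodule.subset_span rfl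
    obtain ⟨f, hf⟩ := Submodule.mem_span_singleton.1 h0
    exact ⟨f, hf.symm⟩
  have h0 : ∀ f : MvPolynomial ι K, f • (1 : End K (MvPolynomial ι K)) = 0 → f = 0 :=
    fun f hf => by simpa using LinearMap.congr_fun hf 1
  obtain ⟨b, hb⟩ := exists_basis_of_generator (preservingOps Q 0) h1 hgen h0
  refine ⟨b, fun j => ?_⟩
  have := isHomogeneousOp_smul_const (isHomogeneous_one ι K)
    (one_mem_constOps (K := K) (ι := ι))
  rw [one_smul] at this
  rwa [hb]

variable {x A}

theorem isMFree_zero : A.IsMFree x 0 := by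
  classical
  rw [IsMFree, diffModule_eq_preservingOps]
  obtain ⟨b, _⟩ := exists_basis_preservingOps_zero (A.definingPoly x)
  exact Module.Free.of_basis b

theorem exists_homogeneous_basis_of_projective_preservingOps [CharZero K] [DecidableEq ι]
    {Q : MvPolynomial ι K} {r : ℕ} (hQ : Q.IsHomogeneous r) {m : ℕ}
    (hproj : Module.Projective (MvPolynomial ι K) (preservingOps Q m)) :
    ∃ (n : ℕ) (b : Basis (Fin n) (MvPolynomial ι K) (preservingOps Q m)) (d : Fin n → ℕ),
      ∀ j, IsHomogeneousOp K m (d j) (b j : End K (MvPolynomial ι K)) := by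
  obtain ⟨n, b, d, h⟩ := exists_homogeneous_basis_of_projective (N := preservingOps Q m)
    (opCoord_injective Q m) (coordGraded_opCoord hQ m)
  exact ⟨n, b, d, fun j => coordHomogeneous_opCoord_iff.1 (h j)⟩

theorem isMFree_of_projective [CharZero K] {m : ℕ}
    (hproj : Module.Projective (MvPolynomial ι K) (preservingOps (A.definingPoly x) m)) :
    A.IsMFree x m := by
  classical
  rw [IsMFree, diffModule_eq_preservingOps]
  obtain ⟨n, b, _⟩ := exists_homogeneous_basis_of_projective_preservingOps
    (definingPoly_isHomogeneous x A) hproj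
  exact Module.Free.of_basis b

variable [DecidableEq ι]

theorem isExponents_of_basis {κ : Type*} [Fintype κ] {m : ℕ} (hm : 1 ≤ m)
    (b : Basis κ (MvPolynomial ι K) (preservingOps (A.definingPoly x) m)) (d : κ → ℕ)
    (h : ∀ j, IsHomogeneousOp K m (d j) (b j : End K (MvPolynomial ι K))) :
    A.IsExponents x m (Finset.univ.val.map d) := by
  let e := Fintype.equivFin κ
  let b' := (b.map (LinearEquiv.ofEq _ _ (diffModule_eq_preservingOps x A m).symm)).reindex e
  refine Or.inr ⟨hm, Fintype.card κ, b', fun j => d (e.symm j), fun j => ?_, ?_⟩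
  · have hb' : (b' j : End K (MvPolynomial ι K)) = b (e.symm j) := by
      rw [Basis.reindex_apply, Basis.map_apply]
      rfl
    rw [hb']
    exact h _
  · conv_lhs => rw [← Finset.map_univ_equiv e.symm, Finset.map_val, Multiset.map_map]
    rfl

theorem exists_isExponents [CharZero K] {m : ℕ} (hm : 1 ≤ m) (hfree : A.IsMFree x m) :
    ∃ E, A.IsExponents x m E := by
  rw [IsMFree, diffModule_eq_preservingOps] at hfree
  have hproj : Module.Projective (MvPolynomial ι K) (preservingOps (A.definingPoly x) m) :=
    inferInstance
  obtain ⟨n, b, d, h⟩ := exists_homogeneous_basis_of_projective_preservingOps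
    (definingPoly_isHomogeneous x A) hproj
  exact ⟨_, isExponents_of_basis hm b d h⟩

theorem IsExponents.exists_basis {m : ℕ} {E : Multiset ℕ} (hE : A.IsExponents x m E) :
    ∃ (n : ℕ) (b : Basis (Fin n) (MvPolynomial ι K) (preservingOps (A.definingPoly x) m))
      (d : Fin n → ℕ), (∀ j, IsHomogeneousOp K m (d j) (b j : End K (MvPolynomial ι K))) ∧
        E = Finset.univ.val.map d := by
  rcases hE with ⟨rfl, rfl⟩ | ⟨_, n, b, d, h, rfl⟩
  · obtain ⟨b, h⟩ := exists_basis_preservingOps_zero (A.definingPoly x)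
    exact ⟨1, b, fun _ => 0, h, rfl⟩
  · exact ⟨n, b.map (LinearEquiv.ofEq _ _ (diffModule_eq_preservingOps x A m)), d, fun j => by
      rw [Basis.map_apply]; exact h j, rfl⟩

theorem IsExponents.isMFree {m : ℕ} {E : Multiset ℕ} (h : A.IsExponents x m E) : A.IsMFree x m := by
  obtain ⟨n, b, _⟩ := h.exists_basis
  rw [IsMFree, diffModule_eq_preservingOps]
  exact Module.Free.of_basis b

theorem IsExponents.unique [CharZero K] {m : ℕ} {E E' : Multiset ℕ} (hE : A.IsExponents x m E)
    (hE' : A.IsExponents x m E') : E = E' := by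
  obtain ⟨n, b, d, h, rfl⟩ := hE.exists_basis
  obtain ⟨n', b', d', h', rfl⟩ := hE'.exists_basis
  exact degrees_eq_of_homogeneous_bases (N := preservingOps (A.definingPoly x) m)
    (c := opCoord (A.definingPoly x) m) (opCoord_injective _ m) b b'
    (fun j => coordHomogeneous_opCoord_iff.2 (h j))
    (fun j => coordHomogeneous_opCoord_iff.2 (h' j))

end Exponents

end CentralArrangement

namespace CentralArrangement

/-! ### Multisets of degree sums -/

section Multisets

theorem univ_map_val_eq_sum {κ α : Type*} [Fintype κ] (f : κ → α) :
    Finset.univ.val.map f = ∑ k, ({f k} : Multiset α) := by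
  rw [Finset.sum_eq_multiset_sum, ← Multiset.sum_map_singleton (Multiset.map f _), Multiset.map_map]
  rfl

theorem univ_sigma_map {κ α : Type*} {κ' : κ → Type*} [Fintype κ] [∀ k, Fintype (κ' k)]
    (f : (Σ k, κ' k) → α) :
    Finset.univ.val.map f = ∑ k, Finset.univ.val.map fun j => f ⟨k, j⟩ := by
  simp only [univ_map_val_eq_sum]
  exact Fintype.sum_sigma _

theorem product_map_add {κ κ' : Type*} [Fintype κ] [Fintype κ'] (f : κ → ℕ) (g : κ' → ℕ) :
    ((Finset.univ.val.map f) ×ˢ (Finset.univ.val.map g)).map (fun p => p.1 + p.2) =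
      Finset.univ.val.map fun k : κ × κ' => f k.1 + g k.2 := by
  rw [← Finset.univ_product_univ, Finset.product_val]
  simp [SProd.sprod, Multiset.product, Multiset.map_bind, Multiset.bind_map]

theorem univ_map_sigma_add {P : Type*} [Fintype P] {κ κ' : P → Type*} [∀ p, Fintype (κ p)]
    [∀ p, Fintype (κ' p)] (d : ∀ p, κ p → ℕ) (e : ∀ p, κ' p → ℕ) :
    (Finset.univ.val.map fun k : Σ k : Σ p, κ p, κ' k.1 => d k.1.1 k.1.2 + e k.1.1 k.2) =
      ∑ p, ((Finset.univ.val.map (d p)) ×ˢ (Finset.univ.val.map (e p))).map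
        (fun q => q.1 + q.2) := by
  rw [univ_sigma_map, Fintype.sum_sigma]
  refine Finset.sum_congr rfl fun p _ => ?_
  rw [product_map_add, univ_map_val_eq_sum, Fintype.sum_prod_type]
  simp only [univ_map_val_eq_sum]

theorem sum_antidiagonal_attach {α : Type*} [AddCommMonoid α] (m : ℕ) (f : ℕ → ℕ → α) :
    ∑ p : Finset.HasAntidiagonal.antidiagonal m, f p.1.1 p.1.2 =
      ∑ i ∈ Finset.range (m + 1), f i (m - i) := by
  rw [← Finset.Nat.sum_antidiagonal_eq_sum_range_succ f m]
  exact Finset.sum_coe_sort _ fun p : ℕ × ℕ => f p.1 p.2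

end Multisets

theorem nonempty_of_finrank_pos {K V ι : Type*} [Field K] [AddCommGroup V] [Module K V]
    (hV : 0 < finrank K V) (x : Basis ι K (Dual K V)) : Nonempty ι := by
  by_contra h
  rw [not_nonempty_iff] at h
  rw [← Subspace.dual_finrank_eq, finrank_eq_nat_card_basis x, Nat.card_of_isEmpty] at hV
  exact lt_irrefl 0 hV

/-! ### Freeness and exponents of the product -/

section ProductFreeness

variable {K V₁ V₂ ι₁ ι₂ ι : Type*} [Field K] [CharZero K] [AddCommGroup V₁] [Module K V₁]
  [AddCommGroup V₂] [Module K V₂] [Fintype ι₁] [Fintype ι₂] [Fintype ι]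
  {x : Basis ι₁ K (Dual K V₁)} {y : Basis ι₂ K (Dual K V₂)} {z : Basis ι K (Dual K (V₁ × V₂))}
  {A₁ : CentralArrangement K V₁} {A₂ : CentralArrangement K V₂} {m : ℕ}

theorem IsMFree.left_of_prod (x : Basis ι₁ K (Dual K V₁)) (y : Basis ι₂ K (Dual K V₂))
    [Nonempty ι₂] (h : (A₁.prod A₂).IsMFree z m) {i : ℕ} (hi : i ≤ m) :
    A₁.IsMFree x i := by
  rw [IsMFree, diffModule_prod_eq x y z] at h
  exact isMFree_of_projective ((isLinearTensorEquiv_prodEquiv x y z).projective_left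
    (definingPoly_ne_zero x A₁) (definingPoly_ne_zero y A₂) hi h)

theorem IsMFree.right_of_prod (x : Basis ι₁ K (Dual K V₁)) (y : Basis ι₂ K (Dual K V₂))
    [Nonempty ι₁] (h : (A₁.prod A₂).IsMFree z m) {i : ℕ} (hi : i ≤ m) :
    A₂.IsMFree y i := by
  rw [IsMFree, diffModule_prod_eq x y z, ← swapFactors_tmul] at h
  exact isMFree_of_projective ((isLinearTensorEquiv_prodEquiv x y z).swap.projective_left
    (definingPoly_ne_zero y A₂) (definingPoly_ne_zero x A₁) hi h)

variable [DecidableEq ι₁] [DecidableEq ι₂] [DecidableEq ι]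

theorem isExponents_prod {d e : ℕ → Multiset ℕ}
    (h : ∀ i ≤ m, A₁.IsExponents x i (d i) ∧ A₂.IsExponents y i (e i)) :
    (A₁.prod A₂).IsExponents z m (∑ i ∈ Finset.range (m + 1),
      (d i ×ˢ e (m - i)).map (fun p => p.1 + p.2)) := by
  have hp (p : Finset.HasAntidiagonal.antidiagonal m) : p.1.1 + p.1.2 = m :=
    Finset.HasAntidiagonal.mem_antidiagonal.1 p.2
  -- For `m = 0` exponents are a convention rather than degrees of a basis, so the formula is
  -- checked directly.
  rcases Nat.eq_zero_or_pos m with rfl | hm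
  · obtain ⟨h₁ | h₁, h₂ | h₂⟩ := h 0 le_rfl
    · exact Or.inl ⟨rfl, by simp [h₁.2, h₂.2]⟩
    all_goals omega
  · have h₁ (p : Finset.HasAntidiagonal.antidiagonal m) :=
      (h p.1.1 (by have := hp p; omega)).1.exists_basis
    have h₂ (p : Finset.HasAntidiagonal.antidiagonal m) :=
      (h p.1.2 (by have := hp p; omega)).2.exists_basis
    choose n θ d' hθ hd using h₁
    choose n' η e' hη he using h₂
    have hΨ := isLinearTensorEquiv_prodEquiv x y z
    obtain ⟨b, hb⟩ := hΨ.exists_box_basis θ η (definingPoly_ne_zero x A₁)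
      (definingPoly_ne_zero y A₂)
    rw [← sum_antidiagonal_attach m fun i j => (d i ×ˢ e j).map (fun p => p.1 + p.2)]
    simp only [hd, he]
    rw [← univ_map_sigma_add]
    refine isExponents_of_basis hm (b.map (LinearEquiv.ofEq _ _
      (preservingOps_congr (associated_definingPoly_prod x y z A₁ A₂) m))) _ fun k => ?_
    rw [coe_basis_map_ofEq, hb]
    have := hΨ.box_isHomogeneousOp (hθ k.1.1 k.1.2) (hη k.1.1 k.2)
    rwa [hp] at this

theorem existsUnique_isExponents {V : Type*} [AddCommGroup V] [Module K V]
    {x : Basis ι K (Dual K V)} {A : CentralArrangement K V} (h : A.IsMFree x m) :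
    ∃! E, A.IsExponents x m E := by
  rcases Nat.eq_zero_or_pos m with rfl | hm
  · exact ⟨{0}, Or.inl ⟨rfl, rfl⟩, fun E hE => hE.unique (Or.inl ⟨rfl, rfl⟩)⟩
  · obtain ⟨E, hE⟩ := exists_isExponents hm h
    exact ⟨E, hE, fun E' hE' => hE'.unique hE⟩

theorem isMFree_prod (h : ∀ i ≤ m, A₁.IsMFree x i ∧ A₂.IsMFree y i) :
    (A₁.prod A₂).IsMFree z m := by
  choose! d hd using fun i hi => (existsUnique_isExponents (h i hi).1).exists
  choose! e he using fun i hi => (existsUnique_isExponents (h i hi).2).exists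
  exact (isExponents_prod fun i hi => ⟨hd i hi, he i hi⟩).isMFree

end ProductFreeness

end CentralArrangement

theorem theorem1p1 {K V₁ V₂ ι₁ ι₂ ι : Type*} [Field K] [CharZero K]
    [AddCommGroup V₁] [Module K V₁] [FiniteDimensional K V₁]
    [AddCommGroup V₂] [Module K V₂] [FiniteDimensional K V₂]
    [Fintype ι₁] [DecidableEq ι₁] [Fintype ι₂] [DecidableEq ι₂] [Fintype ι] [DecidableEq ι]
    (hV₁ : 0 < Module.finrank K V₁) (hV₂ : 0 < Module.finrank K V₂)
    (x : Module.Basis ι₁ K (Module.Dual K V₁)) (y : Module.Basis ι₂ K (Module.Dual K V₂))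
    (z : Module.Basis ι K (Module.Dual K (V₁ × V₂)))
    (A₁ : CentralArrangement K V₁) (A₂ : CentralArrangement K V₂) (m : ℕ) :
    ((A₁.prod A₂).IsMFree z m ↔ ∀ i, 1 ≤ i → i ≤ m → A₁.IsMFree x i ∧ A₂.IsMFree y i) ∧
    ((A₁.prod A₂).IsMFree z m → ∀ i ≤ m,
      (∃! d : Multiset ℕ, A₁.IsExponents x i d) ∧ ∃! e : Multiset ℕ, A₂.IsExponents y i e) ∧
    (∀ d e : ℕ → Multiset ℕ,
      (∀ i ≤ m, A₁.IsExponents x i (d i) ∧ A₂.IsExponents y i (e i)) →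
      ∀ E : Multiset ℕ, (A₁.prod A₂).IsExponents z m E ↔
        E = ∑ i ∈ Finset.range (m + 1),
          (d i ×ˢ e (m - i)).map (fun p => p.1 + p.2)) := by
  have := CentralArrangement.nonempty_of_finrank_pos hV₁ x
  have := CentralArrangement.nonempty_of_finrank_pos hV₂ y
  refine ⟨⟨fun h i _ hi => ⟨h.left_of_prod x y hi, h.right_of_prod x y hi⟩, fun h => ?_⟩,
    fun h i hi => ⟨CentralArrangement.existsUnique_isExponents (h.left_of_prod x y hi),
      CentralArrangement.existsUnique_isExponents (h.right_of_prod x y hi)⟩,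
    fun d e h E => ⟨fun hE => hE.unique (CentralArrangement.isExponents_prod h), ?_⟩⟩
  · refine CentralArrangement.isMFree_prod (x := x) (y := y) fun i hi => ?_
    -- The hypothesis covers only `1 ≤ i`; freeness in order zero is automatic.
    rcases Nat.eq_zero_or_pos i with rfl | hi0
    · exact ⟨CentralArrangement.isMFree_zero, CentralArrangement.isMFree_zero⟩
    · exact h i hi0 hi
  · rintro rfl
    exact CentralArrangement.isExponents_prod h
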